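/- Let $\mathbb{D}$ be the open unit disc and $m$ the normalized Lebesgue measure on the unit circle $\mathbb{T}$. For $1\le p<\infty$ let $H^p$ be the Hardy space of all holomorphic functions $f$ on $\mathbb{D}$ with \[ \|f\|_p=\Big(\sup_{0<r<1}\int_{\mathbb{T}}|f(rz)|^p\,dm(z)\Big)^{1/p}<\infty . \] For each integer $k\ge 2$ put \[ h_k(z)=\frac1k\,\frac1{1-z}\,\log\Big(\frac{1+z+\dots+z^{k-1}}{k}\Big)\qquad(z\in\mathbb{D}), \] where $\log$ is the principal branch; then $h_k\in H^p$ for $1\le p\le 2$. Let $\mathbf 1$ be the constant function with value $1$, let $\zeta$ be the Riemann zeta function, and let $\overline{\mathrm{span}}_{H^p}\{h_k\mid k\ge2\}$ be the closure in $H^p$ of the complex linear span. **Theorem.** Let $1<p\le 2$. 1. If $\mathbf 1\in\overline{\mathrm{span}}_{H^p}\{h_k\mid k\ge 2\}$, then $\zeta(s)\ne 0$ for all $s\in\mathbb{C}$ with $\Re(s)>1/p$. 2. $\mathbf 1\in\overline{\mathrm{span}}_{H^p}\{h_k\mid k\ge 2\}$ if and only if $\mathrm{span}\{h_k\mid k\ge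 2\}$ is dense in $H^p$. Moreover, in the case $p=1$: if $\mathbf 1\in\overline{\mathrm{span}}_{H^1}\{h_k\mid k\ge 2\}$, then $\zeta(s)\ne0$ for all $s$ with $\Re(s)\ge1$ (a half-plane already known unconditionally to be zero-free). -/

import Mathlib

noncomputable section

open MeasureTheory Complex Set
open scoped ENNReal Complex.UnitDisc

namespace HardyDisc

/-- The extension by zero to `ℂ` of a function on the open unit disc. -/
def extZero (f : 𝔻 → ℂ) : ℂ → ℂ := Function.extend UnitDisc.coe f 0

/-- A function on the open unit disc is holomorphic. -/
def Holo (f : 𝔻 → ℂ) : Prop := DifferentiableOn ℂ (extZero f) (Metric.ball 0 1)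

/-- Normalized Lebesgue measure on the circle, in the angular variable `θ ∈ (0, 2π]`. -/
def circleProb : Measure ℝ :=
  (ENNReal.ofReal (2 * Real.pi))⁻¹ • volume.restrict (Ioc 0 (2 * Real.pi))

/-- The integral `∫_𝕋 |f(rz)|^p dm(z)`. -/
def meanPow (p : ℝ) (f : 𝔻 → ℂ) (r : ℝ) : ℝ≥0∞ :=
  ∫⁻ θ, ‖extZero f (circleMap 0 r θ)‖ₑ ^ p ∂circleProb

/-- `‖f‖_p = (sup_{0 < r < 1} ∫_𝕋 |f(rz)|^p dm(z))^{1/p}`, with values in `[0, ∞]`. -/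
def hardyENorm (p : ℝ) (f : 𝔻 → ℂ) : ℝ≥0∞ :=
  (⨆ r : Ioo (0 : ℝ) 1, meanPow p f r) ^ (1 / p)

theorem extZero_coe (f : 𝔻 → ℂ) (z : 𝔻) : extZero f z = f z :=
  UnitDisc.coe_injective.extend_apply f 0 z

theorem extZero_of_norm_lt (f : 𝔻 → ℂ) {z : ℂ} (hz : ‖z‖ < 1) :
    extZero f z = f (UnitDisc.mk z hz) := extZero_coe f (UnitDisc.mk z hz)

theorem extZero_add (f g : 𝔻 → ℂ) : extZero (f + g) = extZero f + extZero g := by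
  unfold extZero
  simpa using Function.extend_add UnitDisc.coe f g 0 0

theorem extZero_smul (c : ℂ) (f : 𝔻 → ℂ) : extZero (c • f) = c • extZero f := by
  unfold extZero
  simpa using Function.extend_smul c UnitDisc.coe f 0

/-- If a function on the disc agrees with a function that is differentiable there,
it is holomorphic. -/
theorem Holo.of_eq {f : 𝔻 → ℂ} {F : ℂ → ℂ} (hF : DifferentiableOn ℂ F (Metric.ball 0 1))
    (h : ∀ z : 𝔻, f z = F z) : Holo f := by
  refine hF.congr fun z hz => ?_
  have hz' : ‖z‖ < 1 := by simpa using hz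
  rw [extZero_of_norm_lt f hz', h]; rfl

theorem Holo.continuous_circle {f : 𝔻 → ℂ} (hf : Holo f) {r : ℝ} (hr : r ∈ Ioo (0 : ℝ) 1) :
    Continuous fun θ => extZero f (circleMap 0 r θ) := by
  refine hf.continuousOn.comp_continuous (continuous_circleMap 0 r) fun θ => ?_
  simp [abs_of_pos hr.1, hr.2]

theorem meanPow_rpow_le (p : ℝ) (hp : 0 < p) (f : 𝔻 → ℂ) {r : ℝ} (hr : r ∈ Ioo (0 : ℝ) 1) :
    meanPow p f r ^ (1 / p) ≤ hardyENorm p f :=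
  ENNReal.rpow_le_rpow (le_iSup (fun r : Ioo (0 : ℝ) 1 => meanPow p f r) ⟨r, hr⟩) (by positivity)

theorem hardyENorm_add_le {p : ℝ} (hp : 1 ≤ p) {f g : 𝔻 → ℂ} (hf : Holo f) (hg : Holo g) :
    hardyENorm p (f + g) ≤ hardyENorm p f + hardyENorm p g := by
  have hp0 : 0 < p := by linarith
  rw [hardyENorm, one_div, ENNReal.rpow_inv_le_iff hp0]
  refine iSup_le fun r => ?_
  rw [← ENNReal.rpow_inv_le_iff hp0, ← one_div]
  have hle : meanPow p (f + g) r ≤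
      ∫⁻ θ, ((fun θ => ‖extZero f (circleMap 0 r θ)‖ₑ) +
        (fun θ => ‖extZero g (circleMap 0 r θ)‖ₑ)) θ ^ p ∂circleProb := by
    refine lintegral_mono fun θ => ENNReal.rpow_le_rpow ?_ hp0.le
    simp only [extZero_add, Pi.add_apply]
    exact enorm_add_le _ _
  refine (ENNReal.rpow_le_rpow hle (by positivity)).trans ?_
  refine (ENNReal.lintegral_Lp_add_le (hf.continuous_circle r.2).enorm.measurable.aemeasurable
    (hg.continuous_circle r.2).enorm.measurable.aemeasurable hp).trans ?_
  exact add_le_add (meanPow_rpow_le p hp0 f r.2) (meanPow_rpow_le p hp0 g r.2)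

theorem hardyENorm_smul {p : ℝ} (hp : 1 ≤ p) (c : ℂ) (f : 𝔻 → ℂ) :
    hardyENorm p (c • f) = ‖c‖ₑ * hardyENorm p f := by
  have hp0 : 0 < p := by linarith
  have h (r : ℝ) : meanPow p (c • f) r = ‖c‖ₑ ^ p * meanPow p f r := by
    simp only [meanPow, extZero_smul, Pi.smul_apply, enorm_smul, ENNReal.mul_rpow_of_nonneg _ _ hp0.le]
    rw [lintegral_const_mul']
    exact ENNReal.rpow_ne_top_of_nonneg hp0.le enorm_ne_top
  simp only [hardyENorm, h]
  rw [← ENNReal.mul_iSup, ENNReal.mul_rpow_of_nonneg _ _ (by positivity), ← ENNReal.rpow_mul,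
    mul_one_div_cancel hp0.ne', ENNReal.rpow_one]

theorem Holo.eq_zero {p : ℝ} (hp : 1 ≤ p) {f : 𝔻 → ℂ} (hf : Holo f) (h : hardyENorm p f = 0) :
    f = 0 := by
  have hp0 : 0 < p := by linarith
  have h1 : ∀ r ∈ Ioo (0 : ℝ) 1, meanPow p f r = 0 := fun r hr => by
    have := (meanPow_rpow_le p hp0 f hr).trans h.le
    simpa [hp0, hp0.not_gt] using this
  have h2 : ∀ z : ℂ, z ≠ 0 → ‖z‖ < 1 → extZero f z = 0 := by
    intro z hz0 hz
    have hr : ‖z‖ ∈ Ioo (0 : ℝ) 1 := ⟨by positivity, hz⟩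
    have h3 := h1 _ hr
    have hc := hf.continuous_circle hr
    rw [meanPow, circleProb, lintegral_smul_measure, smul_eq_mul, mul_eq_zero] at h3
    have h4 := h3.resolve_left (ENNReal.inv_ne_zero.2 ENNReal.ofReal_ne_top)
    rw [lintegral_eq_zero_iff (hc.enorm.measurable.pow_const p)] at h4
    have h5 : (fun θ => extZero f (circleMap 0 ‖z‖ θ)) =ᵐ[volume.restrict (Ioc 0 (2 * Real.pi))]
        fun _ => 0 := by
      filter_upwards [h4] with θ hθ
      simpa [hp0, hp0.not_gt] using hθ
    have h6 := Measure.eqOn_Ioc_of_ae_eq volume h5 hc.continuousOn continuousOn_const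
    have hm : z ∈ Metric.sphere (0 : ℂ) ‖z‖ := by simp
    rw [← abs_of_pos hr.1, ← image_circleMap_Ioc] at hm
    obtain ⟨θ, hθ, hθz⟩ := hm
    simpa [hθz] using h6 hθ
  ext z
  rw [← extZero_coe f z, Pi.zero_apply]
  by_cases hz : (z : ℂ) = 0
  · have hcont : ContinuousAt (extZero f) 0 :=
      hf.continuousOn.continuousAt (Metric.ball_mem_nhds 0 one_pos)
    have hev : (fun _ => (0 : ℂ)) =ᶠ[nhdsWithin 0 {0}ᶜ] extZero f := by
      filter_upwards [self_mem_nhdsWithin,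
        mem_nhdsWithin_of_mem_nhds (Metric.ball_mem_nhds (0 : ℂ) one_pos)] with w hw hw1
      exact (h2 w hw (by simpa using hw1)).symm
    rw [hz]
    exact tendsto_nhds_unique (hcont.tendsto.mono_left nhdsWithin_le_nhds)
      (tendsto_const_nhds.congr' hev)
  · exact h2 z hz z.norm_lt_one

theorem hardyENorm_zero {p : ℝ} (hp : 1 ≤ p) : hardyENorm p 0 = 0 := by
  have h := hardyENorm_smul hp 0 0
  rwa [smul_zero, enorm_zero, zero_mul] at h

/-- The functions in `H^p`, as a linear subspace of the functions on the disc. -/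
def hardySubmodule (p : ℝ) (hp : 1 ≤ p) : Submodule ℂ (𝔻 → ℂ) where
  carrier := {f | Holo f ∧ hardyENorm p f < ∞}
  add_mem' {f g} hf hg :=
    ⟨by rw [Holo, extZero_add]; exact hf.1.add hg.1,
      (hardyENorm_add_le hp hf.1 hg.1).trans_lt (ENNReal.add_lt_top.2 ⟨hf.2, hg.2⟩)⟩
  zero_mem' := by
    refine ⟨Holo.of_eq (differentiableOn_const 0) fun z => rfl, ?_⟩
    rw [hardyENorm_zero hp]
    exact ENNReal.zero_lt_top
  smul_mem' c f hf :=
    ⟨by rw [Holo, extZero_smul]; exact hf.1.const_smul c,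
      by rw [hardyENorm_smul hp]; exact ENNReal.mul_lt_top enorm_lt_top hf.2⟩

/-- The Hardy space `H^p` of the unit disc, `1 ≤ p < ∞`. -/
def HardySpace (p : ℝ) (hp : 1 ≤ p) : Type := hardySubmodule p hp

variable {p : ℝ} {hp : 1 ≤ p}

instance : AddCommGroup (HardySpace p hp) := inferInstanceAs (AddCommGroup (hardySubmodule p hp))

instance : Module ℂ (HardySpace p hp) := inferInstanceAs (Module ℂ (hardySubmodule p hp))

instance : CoeFun (HardySpace p hp) fun _ => 𝔻 → ℂ := ⟨fun f => f.1⟩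

/-- The norm and the topology of `H^p` are those of `‖f‖_p`. -/
instance : NormedAddCommGroup (HardySpace p hp) :=
  AddGroupNorm.toNormedAddCommGroup
    { toFun := fun f => (hardyENorm p f.1).toReal
      map_zero' := by
        change (hardyENorm p 0).toReal = 0
        rw [hardyENorm_zero hp, ENNReal.toReal_zero]
      add_le' := fun f g => by
        rw [← ENNReal.toReal_add f.2.2.ne g.2.2.ne]
        exact ENNReal.toReal_mono (ENNReal.add_ne_top.2 ⟨f.2.2.ne, g.2.2.ne⟩)
          (hardyENorm_add_le hp f.2.1 g.2.1)
      neg' := fun f => by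
        change (hardyENorm p (-f.1)).toReal = _
        rw [← neg_one_smul ℂ f.1, hardyENorm_smul hp]
        simp
      eq_zero_of_map_eq_zero' := fun f hf =>
        Subtype.ext (f.2.1.eq_zero hp
          (((ENNReal.toReal_eq_zero_iff _).1 hf).resolve_right f.2.2.ne)) }

theorem HardySpace.norm_def (f : HardySpace p hp) : ‖f‖ = (hardyENorm p f).toReal := rfl

instance : NormedSpace ℂ (HardySpace p hp) where
  norm_smul_le c f := by
    change (hardyENorm p (c • f.1)).toReal ≤ _
    rw [hardyENorm_smul hp, ENNReal.toReal_mul, HardySpace.norm_def]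
    simp

instance : IsProbabilityMeasure circleProb := by
  constructor
  simp only [circleProb, Measure.smul_apply, MeasurableSet.univ, Measure.restrict_apply,
    univ_inter, Real.volume_Ioc, sub_zero, smul_eq_mul]
  exact ENNReal.inv_mul_cancel (by simp [Real.pi_pos]) ENNReal.ofReal_ne_top

/-- The constant function `1` as an element of `H^p`. -/
instance : One (HardySpace p hp) where
  one := ⟨fun _ => 1, Holo.of_eq (differentiableOn_const 1) fun _ => rfl, by
    have hp0 : 0 < p := by linarith
    refine ENNReal.rpow_lt_top_of_nonneg (by positivity)
      (ne_top_of_le_ne_top ENNReal.one_ne_top (iSup_le fun r => ?_))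
    have : ∀ θ, extZero (fun _ => 1) (circleMap 0 r θ) = 1 := fun θ => by
      rw [extZero_of_norm_lt]; simp [abs_of_pos r.2.1, r.2.2]
    simp [meanPow, this]⟩

theorem HardySpace.one_apply (z : 𝔻) : (1 : HardySpace p hp) z = 1 := rfl

theorem meanPow_two_le {f : 𝔻 → ℂ} {c : ℕ → ℂ} (hc : Summable fun n => ‖c n‖ ^ 2)
    (hf : ∀ z : 𝔻, HasSum (fun n => c n * (z : ℂ) ^ n) (f z)) {r : ℝ} (hr : r ∈ Ioo (0 : ℝ) 1) :
    meanPow 2 f r ≤ ENNReal.ofReal (∑' n, ‖c n‖ ^ 2) := by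
  let P : ℕ → Polynomial ℂ := fun N =>
    ∑ n ∈ Finset.range N, Polynomial.monomial n (c n * (r : ℂ) ^ n)
  have hcoeff : ∀ N i, (P N).coeff i = if i < N then c i * (r : ℂ) ^ i else 0 := by
    intro N i
    simp [P, Polynomial.coeff_monomial]
  have hint : ∀ N, ∫⁻ θ, ‖(P N).eval (circleMap 0 1 θ)‖ₑ ^ (2 : ℝ) ∂circleProb ≤
      ENNReal.ofReal (∑' n, ‖c n‖ ^ 2) := by
    intro N
    have hcont : Continuous fun θ => ‖(P N).eval (circleMap 0 1 θ)‖ ^ 2 :=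
      ((P N).continuous.comp (continuous_circleMap 0 1)).norm.pow 2
    have e1 : ∫⁻ θ, ‖(P N).eval (circleMap 0 1 θ)‖ₑ ^ (2 : ℝ) ∂circleProb =
        ENNReal.ofReal (Real.circleAverage (fun θ => ‖(P N).eval θ‖ ^ 2) 0 1) := by
      rw [Real.circleAverage, intervalIntegral.integral_of_le (by positivity), circleProb,
        lintegral_smul_measure, smul_eq_mul, smul_eq_mul,
        ENNReal.ofReal_mul (p := (2 * Real.pi)⁻¹) (by positivity),
        ENNReal.ofReal_inv_of_pos (by positivity), ofReal_integral_eq_lintegral_ofReal]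
      · congr 1
        refine lintegral_congr fun θ => ?_
        rw [ENNReal.ofReal_pow (norm_nonneg _), ofReal_norm]
        norm_cast
      · exact (hcont.integrableOn_Icc).mono_set Ioc_subset_Icc_self
      · exact Filter.Eventually.of_forall fun θ => by positivity
    rw [e1, ← Polynomial.sum_sq_norm_coeff_eq_circleAverage]
    refine ENNReal.ofReal_le_ofReal (le_trans (Finset.sum_le_sum fun i _ => ?_)
      (hc.sum_le_tsum _ fun i _ => by positivity))
    rw [hcoeff]
    split_ifs
    · rw [norm_mul, mul_pow]
      refine mul_le_of_le_one_right (by positivity) ?_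
      have : ‖(r : ℂ) ^ i‖ ≤ 1 := by
        rw [norm_pow, Complex.norm_real, Real.norm_of_nonneg hr.1.le]
        exact pow_le_one₀ hr.1.le hr.2.le
      exact pow_le_one₀ (norm_nonneg _) this
    · simp
  have hlim : ∀ θ, Filter.Tendsto (fun N => ‖(P N).eval (circleMap 0 1 θ)‖ₑ ^ (2 : ℝ)) Filter.atTop
      (nhds (‖extZero f (circleMap 0 r θ)‖ₑ ^ (2 : ℝ))) := by
    intro θ
    have hz : ‖circleMap 0 r θ‖ < 1 := by simp [abs_of_pos hr.1, hr.2]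
    rw [extZero_of_norm_lt f hz]
    have h := (hf (UnitDisc.mk _ hz)).tendsto_sum_nat
    have he : ∀ N, (P N).eval (circleMap 0 1 θ) =
        ∑ i ∈ Finset.range N, c i * ((UnitDisc.mk _ hz : 𝔻) : ℂ) ^ i := by
      intro N
      simp only [P, Polynomial.eval_finsetSum, Polynomial.eval_monomial, UnitDisc.coe_mk]
      refine Finset.sum_congr rfl fun i _ => ?_
      simp only [circleMap]
      push_cast
      ring
    simp only [he]
    exact (ENNReal.continuous_rpow_const.tendsto _).comp h.enorm
  calc meanPow 2 f r
      = ∫⁻ θ, Filter.liminf (fun N => ‖(P N).eval (circleMap 0 1 θ)‖ₑ ^ (2 : ℝ)) Filter.atTop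
          ∂circleProb := lintegral_congr fun θ => (hlim θ).liminf_eq.symm
    _ ≤ Filter.liminf (fun N => ∫⁻ θ, ‖(P N).eval (circleMap 0 1 θ)‖ₑ ^ (2 : ℝ) ∂circleProb)
          Filter.atTop := lintegral_liminf_le fun N =>
            ((P N).continuous.comp (continuous_circleMap 0 1)).enorm.measurable.pow_const _
    _ ≤ _ := Filter.liminf_le_of_frequently_le' (Filter.Frequently.of_forall hint)

theorem hardyENorm_lt_top_of_coeff {p : ℝ} (hp : 1 ≤ p) (hp2 : p ≤ 2) {f : 𝔻 → ℂ} {c : ℕ → ℂ}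
    (hc : Summable fun n => ‖c n‖ ^ 2)
    (hf : ∀ z : 𝔻, HasSum (fun n => c n * (z : ℂ) ^ n) (f z)) : hardyENorm p f < ∞ := by
  have hp0 : 0 < p := by linarith
  refine ENNReal.rpow_lt_top_of_nonneg (by positivity)
    (ne_top_of_le_ne_top (b := 1 + ENNReal.ofReal (∑' n, ‖c n‖ ^ 2)) (by simp)
      (iSup_le fun r => ?_))
  refine le_trans ?_ (add_le_add le_rfl (meanPow_two_le hc hf r.2))
  have h1 : (1 : ℝ≥0∞) = ∫⁻ _, 1 ∂circleProb := by simp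
  rw [h1, meanPow, meanPow, ← lintegral_add_left measurable_const]
  refine lintegral_mono fun θ => ?_
  simp only
  rcases le_total ‖extZero f (circleMap 0 r θ)‖ₑ 1 with h | h
  · exact (ENNReal.rpow_le_one h hp0.le).trans le_self_add
  · exact (ENNReal.rpow_le_rpow_of_exponent_le h hp2).trans le_add_self

/-- `h_k(z) = (1/k) · 1/(1-z) · log((1 + z + ⋯ + z^(k-1))/k)` as a function on the disc. -/
def hFun (k : ℕ) (z : 𝔻) : ℂ :=
  1 / (k : ℂ) * (1 / (1 - (z : ℂ))) * log ((∑ j ∈ Finset.range k, (z : ℂ) ^ j) / (k : ℂ))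

theorem one_sub_re_pos {z : ℂ} (hz : ‖z‖ < 1) : 0 < (1 - z).re := by
  have := (le_abs_self _).trans (Complex.abs_re_le_norm z)
  simp only [sub_re, one_re]
  linarith

/-- The principal logarithm in `hFun` is the holomorphic branch on the disc. -/
theorem log_geom {k : ℕ} (hk : k ≠ 0) {z : ℂ} (hz : ‖z‖ < 1) :
    log ((∑ j ∈ Finset.range k, z ^ j) / (k : ℂ)) =
      log (1 - z ^ k) - log (1 - z) - log (k : ℂ) := by
  have hzk : ‖z ^ k‖ < 1 := by rw [norm_pow]; exact pow_lt_one₀ (norm_nonneg _) hz hk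
  have hu := one_sub_re_pos hzk
  have hv := one_sub_re_pos hz
  have hu0 : 1 - z ^ k ≠ 0 := fun h => by simp [h] at hu
  have hv0 : 1 - z ≠ 0 := fun h => by simp [h] at hv
  have hk0 : (k : ℂ) ≠ 0 := by exact_mod_cast hk
  have au := abs_lt.1 (abs_arg_lt_pi_div_two_iff.2 (Or.inl hu))
  have av := abs_lt.1 (abs_arg_lt_pi_div_two_iff.2 (Or.inl hv))
  have hexp : exp (log (1 - z ^ k) - log (1 - z) - log (k : ℂ)) =
      (∑ j ∈ Finset.range k, z ^ j) / (k : ℂ) := by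
    rw [exp_sub, exp_sub, exp_log hu0, exp_log hv0, exp_log hk0, ← mul_neg_geom_sum z k]
    field_simp
  rw [← hexp, log_exp]
  · simp only [sub_im, log_im, natCast_arg]; linarith
  · simp only [sub_im, log_im, natCast_arg]; linarith

/-- The Taylor coefficients of `k • h_k`. -/
def hCoeff (k N : ℕ) : ℝ := (harmonic N : ℝ) - (harmonic (N / k) : ℝ) - Real.log k

theorem abs_harmonic_sub_le (N : ℕ) :
    |(harmonic N : ℝ) - Real.log (N + 1) - Real.eulerMascheroniConstant| ≤ 2 / (N + 1) := by
  have h1 := Real.eulerMascheroniSeq_lt_eulerMascheroniConstant N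
  have h2 := Real.eulerMascheroniConstant_lt_eulerMascheroniSeq' N
  rw [Real.eulerMascheroniSeq] at h1
  rw [Real.eulerMascheroniSeq'] at h2
  rw [abs_le]
  have hpos : (0 : ℝ) ≤ 2 / (N + 1) := by positivity
  refine ⟨?_, by linarith⟩
  split_ifs at h2 with hN
  · subst hN
    have := Real.eulerMascheroniConstant_lt_two_thirds
    simp; linarith
  · have hN' : (1 : ℝ) ≤ N := by exact_mod_cast Nat.one_le_iff_ne_zero.2 hN
    have h3 : Real.log (N + 1) - Real.log N ≤ 1 / N := by
      rw [← Real.log_div (by positivity) (by positivity)]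
      refine (Real.log_le_sub_one_of_pos (by positivity)).trans (le_of_eq ?_)
      field_simp
      ring
    have h4 : (1 : ℝ) / N ≤ 2 / (N + 1) := by
      rw [div_le_div_iff₀ (by positivity) (by positivity)]; linarith
    linarith

theorem abs_hCoeff_le {k : ℕ} (hk : k ≠ 0) (N : ℕ) : |hCoeff k N| ≤ (2 + 3 * k) / (N + 1) := by
  have h1 := abs_le.1 (abs_harmonic_sub_le N)
  have h2 := abs_le.1 (abs_harmonic_sub_le (N / k))
  set M := N / k with hM
  have hkpos : 0 < k := Nat.pos_of_ne_zero hk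
  have hk1 : (0 : ℝ) < k := by exact_mod_cast hkpos
  have ha : ((N : ℝ) + 1) ≤ k * (M + 1) := by
    have : N + 1 ≤ k * (M + 1) := by
      have := Nat.lt_mul_div_succ N hkpos
      rw [← hM] at this
      omega
    exact_mod_cast this
  have hb : (k : ℝ) * (M + 1) ≤ N + k := by
    have : k * (M + 1) ≤ N + k := by
      have := Nat.mul_div_le N k
      rw [← hM] at this
      rw [mul_add, mul_one]; omega
    exact_mod_cast this
  have h3 : (2 : ℝ) / (M + 1) ≤ 2 * k / (N + 1) := by
    rw [div_le_div_iff₀ (by positivity) (by positivity)]; nlinarith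
  have h4 : Real.log (N + 1) ≤ Real.log k + Real.log (M + 1) := by
    rw [← Real.log_mul (by positivity) (by positivity)]
    exact Real.log_le_log (by positivity) ha
  have h5 : Real.log k + Real.log (M + 1) - Real.log (N + 1) ≤ k / (N + 1) := by
    rw [← Real.log_mul (by positivity) (by positivity), ← Real.log_div (by positivity) (by positivity)]
    refine (Real.log_le_sub_one_of_pos (by positivity)).trans ?_
    rw [div_sub_one (by positivity)]
    gcongr
    linarith
  have h6 : (2 + 3 * (k : ℝ)) / (N + 1) = 2 / (N + 1) + 2 * k / (N + 1) + k / (N + 1) := by ring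
  have h7 : (0 : ℝ) ≤ k / (N + 1) := by positivity
  rw [h6, abs_le, hCoeff]
  constructor <;> linarith

theorem summable_hCoeff_sq {k : ℕ} (hk : k ≠ 0) : Summable fun N => |hCoeff k N| ^ 2 := by
  have h : Summable fun N : ℕ => (2 + 3 * (k : ℝ)) ^ 2 * (1 / ((N + 1 : ℕ) : ℝ) ^ 2) :=
    ((summable_nat_add_iff 1).2 (Real.summable_one_div_nat_pow.2 one_lt_two)).mul_left _
  refine Summable.of_nonneg_of_le (fun _ => by positivity) (fun N => ?_) h
  refine (pow_le_pow_left₀ (abs_nonneg _) (abs_hCoeff_le hk N) 2).trans (le_of_eq ?_)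
  rw [div_pow]; push_cast; ring

theorem hasSum_hCoeff {k : ℕ} (hk : k ≠ 0) {z : ℂ} (hz : ‖z‖ < 1) :
    HasSum (fun N => (hCoeff k N : ℂ) * z ^ N)
      (1 / (1 - z) * log ((∑ j ∈ Finset.range k, z ^ j) / (k : ℂ))) := by
  have hzk : ‖z ^ k‖ < 1 := by rw [norm_pow]; exact pow_lt_one₀ (norm_nonneg _) hz hk
  have hv0 : 1 - z ≠ 0 := fun h => by simpa [h] using one_sub_re_pos hz
  -- the series of the logarithms
  have s1 := hasSum_taylorSeries_neg_log hz
  have s2 : HasSum (fun n : ℕ => if k ∣ n then z ^ n / ((n / k : ℕ) : ℂ) else 0)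
      (-log (1 - z ^ k)) := by
    have hinj : Function.Injective fun m : ℕ => k * m := fun a b h =>
      Nat.eq_of_mul_eq_mul_left (Nat.pos_of_ne_zero hk) h
    rw [← hinj.hasSum_iff]
    · refine (hasSum_taylorSeries_neg_log hzk).congr_fun ?_
      intro m
      simp [Nat.mul_div_cancel_left m (Nat.pos_of_ne_zero hk), pow_mul]
    · rintro n hn
      rw [if_neg]
      rintro ⟨m, rfl⟩
      exact hn ⟨m, rfl⟩
  have s3 := (hasSum_nat_add_iff' 1).2 (s1.sub s2)
  -- summability of the coefficients against a geometric sequence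
  have hsum : Summable fun N => (hCoeff k N : ℂ) * z ^ N := by
    refine Summable.of_norm_bounded
      ((summable_geometric_of_lt_one (norm_nonneg z) hz).mul_left (2 + 3 * (k : ℝ))) fun N => ?_
    rw [norm_mul, norm_pow, Complex.norm_real, Real.norm_eq_abs]
    gcongr
    refine (abs_hCoeff_le hk N).trans (div_le_self (by positivity) ?_)
    have : (0 : ℝ) ≤ N := by positivity
    linarith
  obtain ⟨g, hg⟩ := hsum
  have t1 := (hasSum_nat_add_iff' 1).2 hg
  have t2 := t1.sub (hg.mul_left z)
  have hcoe : ∀ N : ℕ, (hCoeff k (N + 1) : ℂ) * z ^ (N + 1) - z * ((hCoeff k N : ℂ) * z ^ N) =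
      z ^ (N + 1) / ((N + 1 : ℕ) : ℂ) -
        if k ∣ N + 1 then z ^ (N + 1) / (((N + 1) / k : ℕ) : ℂ) else 0 := by
    intro N
    have hd : hCoeff k (N + 1) - hCoeff k N =
        1 / ((N + 1 : ℕ) : ℝ) - if k ∣ N + 1 then 1 / (((N + 1) / k : ℕ) : ℝ) else 0 := by
      simp only [hCoeff, harmonic_succ, Nat.succ_div]
      split_ifs with h
      · rw [harmonic_succ]; push_cast; ring_nf
      · push_cast; ring_nf
    have hd' := congrArg (fun x : ℝ => (x : ℂ)) hd
    simp only [ofReal_sub] at hd'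
    have : (hCoeff k (N + 1) : ℂ) * z ^ (N + 1) - z * ((hCoeff k N : ℂ) * z ^ N) =
        ((hCoeff k (N + 1) : ℂ) - hCoeff k N) * z ^ (N + 1) := by ring
    rw [this, hd']
    split_ifs <;> push_cast <;> ring_nf
  simp only [hcoe] at t2
  have key := t2.unique s3
  have hc0 : hCoeff k 0 = -Real.log k := by simp [hCoeff]
  have hlog : log ((∑ j ∈ Finset.range k, z ^ j) / (k : ℂ)) = (1 - z) * g := by
    rw [log_geom hk hz]
    simp [hc0] at key
    linear_combination -key
  rw [hlog, one_div, inv_mul_cancel_left₀ hv0]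
  exact hg

theorem hFun_mem {p : ℝ} (hp : 1 ≤ p) (hp2 : p ≤ 2) (k : ℕ) : hFun k ∈ hardySubmodule p hp := by
  rcases eq_or_ne k 0 with rfl | hk
  · have : hFun 0 = 0 := by ext z; simp [hFun]
    rw [this]; exact Submodule.zero_mem _
  have hk0 : (k : ℂ) ≠ 0 := by exact_mod_cast hk
  constructor
  · refine Holo.of_eq (F := fun z => 1 / (k : ℂ) * (1 / (1 - z)) *
      (log (1 - z ^ k) - log (1 - z) - log (k : ℂ))) ?_ fun z => ?_
    · intro z hz
      have hz' : ‖z‖ < 1 := by simpa using hz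
      have hzk : ‖z ^ k‖ < 1 := by rw [norm_pow]; exact pow_lt_one₀ (norm_nonneg _) hz' hk
      have hv0 : 1 - z ≠ 0 := fun h => by simpa [h] using one_sub_re_pos hz'
      have d1 : DifferentiableAt ℂ (fun z : ℂ => 1 - z) z := by fun_prop
      have d2 : DifferentiableAt ℂ (fun z : ℂ => 1 - z ^ k) z := by fun_prop
      exact (((differentiableAt_const _).mul ((differentiableAt_const _).div d1 hv0)).mul
        (((d2.clog (Or.inl (one_sub_re_pos hzk))).sub
          (d1.clog (Or.inl (one_sub_re_pos hz')))).sub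
            (differentiableAt_const _))).differentiableWithinAt
    · rw [hFun, log_geom hk z.norm_lt_one]
  · refine hardyENorm_lt_top_of_coeff hp hp2 (c := fun N => 1 / (k : ℂ) * (hCoeff k N : ℂ)) ?_ ?_
    · refine ((summable_hCoeff_sq hk).mul_left (‖1 / (k : ℂ)‖ ^ 2)).congr fun N => ?_
      rw [norm_mul, mul_pow, Complex.norm_real, Real.norm_eq_abs]
    · intro z
      have := (hasSum_hCoeff hk z.norm_lt_one).mul_left (1 / (k : ℂ))
      simpa only [hFun, mul_assoc] using this

/-- The function `h_k` as an element of `H^p`, `1 ≤ p ≤ 2`. -/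
def hElem (p : ℝ) (hp : 1 ≤ p) (hp2 : p ≤ 2) (k : ℕ) : HardySpace p hp := ⟨hFun k, hFun_mem hp hp2 k⟩

/-- `span {h_k : k ≥ 2}` in `H^p`, `1 ≤ p ≤ 2`. -/
def hSpan (p : ℝ) (hp : 1 ≤ p) (hp2 : p ≤ 2) : Submodule ℂ (HardySpace p hp) :=
  Submodule.span ℂ {f | ∃ k : ℕ, 2 ≤ k ∧ f = hElem p hp hp2 k}

end HardyDisc

end

/-!
The two parts rest on two properties of the functions `h_k`.

*Zeros of zeta.* For `1/p < re s < 1` the functional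
`Λ f = ∫_0^∞ t ^ (s - 2) (1 - e ^ (-t)) f(e ^ (-t)) dt` is bounded on `H^p`, since
`|f(z)| ≤ C ‖f‖ (1 - |z|) ^ (-1/p)` (`HardySpace.norm_apply_rpow_mul_le`). Its value at `z ^ N` is
`Γ(s)/(s - 1) (N ^ (1 - s) - (N + 1) ^ (1 - s))` (`integral_mellinWeight_mul_exp_pow`), and
summation by parts against the Taylor coefficients of `h_k`, followed by analytic continuation from
`re s > 1` to `re s > 0` (`tsum_pairing_eq`), gives
`Λ h_k = Γ(s)/(k (s - 1)) (1 - k ^ (1 - s)) ζ(s)`. If `ζ(s) = 0`, then `Λ` annihilates the closed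
span of the `h_k`, whereas `Λ 1 = -Γ(s)/(s - 1) ≠ 0`.

*Density.* The operators `W_n f(z) = (1 + z + ⋯ + z^(n-1)) f(z^n)` are bounded on `H^p` and satisfy
`W_n h_k = n h_{nk} - (n/k) h_n` (`powSubst_hElem`), so the closed span is invariant under them. If
it contains `1`, it contains `W_{n+1} 1 - W_n 1 = z ^ n` for every `n`, and polynomials are dense in
`H^p` (`HardySpace.dense_of_monomial_mem`). The density of the polynomials is proved without
boundary values: it suffices that the dilations `f(r z)` tend to `f` in norm, which follows from the
uniform convexity of `|·|^p` for `1 < p` and the fact that integral means increase with the radius,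
a consequence of the Poisson formula.

For `p = 1` the half-plane is `1 ≤ re s`, where zeta has no zeros in any case.
-/

open MeasureTheory Complex Set Filter Topology
open scoped ENNReal Complex.UnitDisc

namespace HardyDisc

/-! ### Integral means on circles and the Hardy norm -/

/-- The real-valued integral mean `∫_𝕋 |G(rz)|^p dm(z)` of a function on the plane. -/
noncomputable def powMean (p : ℝ) (G : ℂ → ℂ) (r : ℝ) : ℝ :=
  Real.circleAverage (fun z => ‖G z‖ ^ p) 0 r

theorem powMean_nonneg (p : ℝ) (G : ℂ → ℂ) (r : ℝ) : 0 ≤ powMean p G r :=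
  Real.circleAverage_nonneg_of_nonneg fun _ _ => by positivity

theorem sphere_subset_unitBall {r : ℝ} (hr : r ∈ Ioo (0 : ℝ) 1) :
    Metric.sphere (0 : ℂ) r ⊆ Metric.ball 0 1 := fun z hz => by
  simp only [mem_sphere_iff_norm, sub_zero, mem_ball_zero_iff] at hz ⊢
  linarith [hr.2]

theorem circleIntegrable_norm_rpow {p : ℝ} (hp : 0 ≤ p) {G : ℂ → ℂ}
    (hG : ContinuousOn G (Metric.ball 0 1)) {r : ℝ} (hr : r ∈ Ioo (0 : ℝ) 1) :
    CircleIntegrable (fun z => ‖G z‖ ^ p) 0 r :=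
  ContinuousOn.circleIntegrable hr.1.le
    (((hG.mono (sphere_subset_unitBall hr)).norm).rpow_const fun _ _ => Or.inr hp)

theorem powMean_le_powMean {p : ℝ} (hp : 0 ≤ p) {G H : ℂ → ℂ} {r : ℝ} (hr : r ∈ Ioo (0 : ℝ) 1)
    (hG : ContinuousOn G (Metric.ball 0 1)) (hH : ContinuousOn H (Metric.ball 0 1))
    (h : ∀ z ∈ Metric.sphere (0 : ℂ) r, ‖G z‖ ≤ ‖H z‖) : powMean p G r ≤ powMean p H r := by
  refine Real.circleAverage_mono (circleIntegrable_norm_rpow hp hG hr)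
    (circleIntegrable_norm_rpow hp hH hr) fun z hz => ?_
  rw [abs_of_pos hr.1] at hz
  exact Real.rpow_le_rpow (norm_nonneg _) (h z hz) hp

theorem powMean_congr (p : ℝ) {G H : ℂ → ℂ} {r : ℝ} (hr : r ∈ Ioo (0 : ℝ) 1)
    (h : EqOn G H (Metric.ball 0 1)) : powMean p G r = powMean p H r := by
  refine Real.circleAverage_congr_sphere fun z hz => ?_
  rw [abs_of_pos hr.1] at hz
  simp only [h (sphere_subset_unitBall hr hz)]

theorem meanPow_eq_ofReal {p : ℝ} (hp : 0 ≤ p) {f : 𝔻 → ℂ} (hf : Holo f) {r : ℝ}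
    (hr : r ∈ Ioo (0 : ℝ) 1) : meanPow p f r = ENNReal.ofReal (powMean p (extZero f) r) := by
  have hcont : Continuous fun θ => ‖extZero f (circleMap 0 r θ)‖ ^ p :=
    (hf.continuous_circle hr).norm.rpow_const fun _ => Or.inr hp
  rw [powMean, Real.circleAverage, intervalIntegral.integral_of_le (by positivity), meanPow,
    circleProb, lintegral_smul_measure, smul_eq_mul, smul_eq_mul,
    ENNReal.ofReal_mul (p := (2 * Real.pi)⁻¹) (by positivity),
    ENNReal.ofReal_inv_of_pos (by positivity), ofReal_integral_eq_lintegral_ofReal]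
  · congr 1
    refine lintegral_congr fun θ => ?_
    rw [← ENNReal.ofReal_rpow_of_nonneg (norm_nonneg _) hp, ofReal_norm]
  · exact (hcont.integrableOn_Icc).mono_set Ioc_subset_Icc_self
  · exact Eventually.of_forall fun θ => by positivity

/-- The restriction to the disc of a function on the plane. -/
def restrictDisc (G : ℂ → ℂ) : 𝔻 → ℂ := fun z => G z

theorem extZero_restrictDisc (G : ℂ → ℂ) :
    EqOn (extZero (restrictDisc G)) G (Metric.ball 0 1) := fun z hz => by
  rw [extZero_of_norm_lt _ (by simpa using hz)]; rfl

theorem hardyENorm_le_of_powMean_le {p : ℝ} (hp : 1 ≤ p) {f : 𝔻 → ℂ} (hf : Holo f) {C : ℝ}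
    (hC : 0 ≤ C) (h : ∀ r ∈ Ioo (0 : ℝ) 1, powMean p (extZero f) r ≤ C ^ p) :
    hardyENorm p f ≤ ENNReal.ofReal C := by
  have hp0 : 0 < p := by linarith
  rw [hardyENorm, one_div, ENNReal.rpow_inv_le_iff hp0]
  refine iSup_le fun r => ?_
  rw [meanPow_eq_ofReal hp0.le hf r.2, ENNReal.ofReal_rpow_of_nonneg hC hp0.le]
  exact ENNReal.ofReal_le_ofReal (h r r.2)

variable {p : ℝ} {hp : 1 ≤ p}

theorem HardySpace.norm_le_of_powMean_le (f : HardySpace p hp) {C : ℝ} (hC : 0 ≤ C)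
    (h : ∀ r ∈ Ioo (0 : ℝ) 1, powMean p (extZero f.1) r ≤ C ^ p) : ‖f‖ ≤ C :=
  ENNReal.toReal_le_of_le_ofReal hC (hardyENorm_le_of_powMean_le hp f.2.1 hC h)

theorem HardySpace.powMean_le (f : HardySpace p hp) {r : ℝ} (hr : r ∈ Ioo (0 : ℝ) 1) :
    powMean p (extZero f.1) r ≤ ‖f‖ ^ p := by
  have hp0 : 0 < p := by linarith
  have h := meanPow_rpow_le p hp0 f.1 hr
  rw [one_div, ENNReal.rpow_inv_le_iff hp0, meanPow_eq_ofReal hp0.le f.2.1 hr,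
    ← ENNReal.ofReal_toReal f.2.2.ne, ENNReal.ofReal_rpow_of_nonneg ENNReal.toReal_nonneg hp0.le,
    ENNReal.ofReal_le_ofReal_iff (by positivity)] at h
  exact h

/-- The means of an element of `H^p` come arbitrarily close to the `p`-th power of its norm. -/
theorem HardySpace.exists_lt_powMean (f : HardySpace p hp) {a : ℝ} (ha : a < ‖f‖ ^ p) :
    ∃ r ∈ Ioo (0 : ℝ) 1, a < powMean p (extZero f.1) r := by
  have hp0 : 0 < p := by linarith
  by_contra! h
  have ha0 : 0 ≤ a := (powMean_nonneg _ _ _).trans (h (1 / 2) (by norm_num))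
  have h1 := f.norm_le_of_powMean_le (C := a ^ p⁻¹) (by positivity) fun r hr => by
    rw [Real.rpow_inv_rpow ha0 hp0.ne']; exact h r hr
  have h2 := Real.rpow_le_rpow (norm_nonneg f) h1 hp0.le
  rw [Real.rpow_inv_rpow ha0 hp0.ne'] at h2
  linarith

/-- A holomorphic function on the disc with bounded integral means, as an element of `H^p`. -/
def HardySpace.ofBound (hp : 1 ≤ p) (G : ℂ → ℂ) (hG : DifferentiableOn ℂ G (Metric.ball 0 1))
    (C : ℝ) (hC : 0 ≤ C) (h : ∀ r ∈ Ioo (0 : ℝ) 1, powMean p G r ≤ C ^ p) : HardySpace p hp :=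
  ⟨restrictDisc G, Holo.of_eq hG fun _ => rfl,
    (hardyENorm_le_of_powMean_le hp (Holo.of_eq hG fun _ => rfl) hC fun r hr =>
      (powMean_congr p hr (extZero_restrictDisc G)).trans_le (h r hr)).trans_lt
        ENNReal.ofReal_lt_top⟩

theorem HardySpace.norm_ofBound_le (G : ℂ → ℂ) (hG : DifferentiableOn ℂ G (Metric.ball 0 1))
    (C : ℝ) (hC : 0 ≤ C) (h : ∀ r ∈ Ioo (0 : ℝ) 1, powMean p G r ≤ C ^ p) :
    ‖HardySpace.ofBound hp G hG C hC h‖ ≤ C :=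
  HardySpace.norm_le_of_powMean_le _ hC fun r hr =>
    (powMean_congr p hr (extZero_restrictDisc G)).trans_le (h r hr)

theorem powMean_le_of_norm_le {p : ℝ} (hp : 0 ≤ p) {G : ℂ → ℂ}
    (hG : ContinuousOn G (Metric.ball 0 1)) {C : ℝ} (h : ∀ z ∈ Metric.ball (0 : ℂ) 1, ‖G z‖ ≤ C)
    {r : ℝ} (hr : r ∈ Ioo (0 : ℝ) 1) : powMean p G r ≤ C ^ p := by
  refine Real.circleAverage_mono_on_of_le_circle (circleIntegrable_norm_rpow hp hG hr)
    fun z hz => ?_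
  rw [abs_of_pos hr.1] at hz
  exact Real.rpow_le_rpow (norm_nonneg _) (h z (sphere_subset_unitBall hr hz)) hp

/-! ### Subharmonicity of `|F|^p` -/

theorem poissonKernel_nonneg {w z : ℂ} (h : ‖w‖ ≤ ‖z‖) : 0 ≤ poissonKernel 0 w z := by
  simp only [poissonKernel_def, sub_zero]
  exact div_nonneg (by nlinarith [norm_nonneg w]) (by positivity)

theorem continuousOn_poissonKernel_sphere {w : ℂ} {R : ℝ} (hw : ‖w‖ < R) :
    ContinuousOn (poissonKernel 0 w) (Metric.sphere 0 R) := by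
  have : ∀ z ∈ Metric.sphere (0 : ℂ) R, ‖z - 0 - (w - 0)‖ ^ 2 ≠ 0 := by
    intro z hz h
    rw [sub_zero, sub_zero, sq_eq_zero_iff, norm_eq_zero, sub_eq_zero] at h
    simp [h] at hz
    linarith
  have h2 : poissonKernel 0 w = fun z => (‖z - 0‖ ^ 2 - ‖w - 0‖ ^ 2) / ‖z - 0 - (w - 0)‖ ^ 2 := by
    ext z; exact poissonKernel_def 0 w z
  rw [h2]
  exact ContinuousOn.div (by fun_prop) (by fun_prop) this

theorem circleAverage_poissonKernel {w : ℂ} {R : ℝ} (hw : ‖w‖ < R) :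
    Real.circleAverage (poissonKernel 0 w) 0 R = 1 := by
  have hd : DiffContOnCl ℂ (fun _ : ℂ => (1 : ℂ)) (Metric.ball 0 R) := diffContOnCl_const
  have h := hd.circleAverage_poissonKernel_smul (w := w) (by simpa using hw)
  have h1 := Complex.reCLM.circleAverage_comp_comm (c := 0) (R := R)
    (f := poissonKernel 0 w • fun _ : ℂ => (1 : ℂ)) ?_
  · rw [h] at h1
    simpa [Function.comp_def] using h1
  · refine ContinuousOn.circleIntegrable ((norm_nonneg _).trans hw.le) ?_
    exact (continuousOn_poissonKernel_sphere hw).smul continuousOn_const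

/-- The graph of the convex function `x ^ p` lies above its tangent line at `a`. -/
theorem rpow_tangent_le {p a x : ℝ} (hp : 1 ≤ p) (ha : 0 < a) (hx : 0 ≤ x) :
    a ^ p + p * a ^ (p - 1) * (x - a) ≤ x ^ p := by
  have h := one_add_mul_self_le_rpow_one_add (s := x / a - 1)
    (by linarith [div_nonneg hx ha.le]) hp
  rw [add_sub_cancel, Real.div_rpow hx ha.le] at h
  have hap : 0 < a ^ p := by positivity
  rw [le_div_iff₀ hap] at h
  rw [Real.rpow_sub_one ha.ne']
  refine le_of_eq_of_le ?_ h
  field_simp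

/-- Subharmonicity: `|F(w)|^p` is at most the Poisson integral of `|F|^p`. -/
theorem norm_rpow_le_circleAverage {p : ℝ} (hp : 1 ≤ p) {F : ℂ → ℂ} {w : ℂ} {R : ℝ}
    (hF : DiffContOnCl ℂ F (Metric.ball 0 R)) (hw : ‖w‖ < R) :
    ‖F w‖ ^ p ≤ Real.circleAverage (fun z => poissonKernel 0 w z * ‖F z‖ ^ p) 0 R := by
  have hR : 0 < R := (norm_nonneg _).trans_lt hw
  have hp0 : 0 < p := by linarith
  have hFc : ContinuousOn F (Metric.sphere 0 R) :=
    hF.continuousOn.mono (by rw [closure_ball 0 hR.ne']; exact Metric.sphere_subset_closedBall)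
  have hP := continuousOn_poissonKernel_sphere hw
  have hnn : ∀ z ∈ Metric.sphere (0 : ℂ) |R|, 0 ≤ poissonKernel 0 w z := fun z hz =>
    poissonKernel_nonneg (by rw [abs_of_pos hR] at hz; simp at hz; linarith)
  rcases (norm_nonneg (F w)).eq_or_lt with h0 | h0
  · rw [← h0, Real.zero_rpow hp0.ne']
    exact Real.circleAverage_nonneg_of_nonneg fun z hz =>
      mul_nonneg (hnn z hz) (by positivity)
  -- the Poisson formula bounds `‖F w‖` by the Poisson integral of `‖F‖`
  have h1 : ‖F w‖ ≤ Real.circleAverage (fun z => poissonKernel 0 w z * ‖F z‖) 0 R := by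
    rw [← hF.circleAverage_poissonKernel_smul (w := w) (by simpa using hw)]
    rw [Real.circleAverage, Real.circleAverage, norm_smul, Real.norm_of_nonneg (by positivity),
      smul_eq_mul]
    gcongr
    refine (intervalIntegral.norm_integral_le_integral_norm (by positivity)).trans_eq ?_
    refine intervalIntegral.integral_congr fun θ _ => ?_
    simp only [Pi.smul_apply', norm_smul]
    rw [Real.norm_of_nonneg (hnn _ (circleMap_mem_sphere' 0 R θ))]
  have i1 : CircleIntegrable (fun z => poissonKernel 0 w z * ‖F z‖) 0 R :=
    ContinuousOn.circleIntegrable hR.le (hP.mul hFc.norm)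
  have i2 : CircleIntegrable (fun z => poissonKernel 0 w z * ‖F z‖ ^ p) 0 R :=
    ContinuousOn.circleIntegrable hR.le
      (hP.mul (hFc.norm.rpow_const fun _ _ => Or.inr hp0.le))
  have i3 : CircleIntegrable (poissonKernel 0 w) 0 R := ContinuousOn.circleIntegrable hR.le hP
  -- averaging the tangent line at `a = ‖F w‖` against the kernel, which has mean `1`, turns `h1`
  -- into the claim without an appeal to Jensen's inequality
  set a := ‖F w‖ with ha
  set c := p * a ^ (p - 1) with hc
  have hc0 : 0 ≤ c := by positivity
  have h2 : Real.circleAverage ((a ^ p - c * a) • poissonKernel 0 w +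
      c • fun z => poissonKernel 0 w z * ‖F z‖) 0 R ≤
      Real.circleAverage (fun z => poissonKernel 0 w z * ‖F z‖ ^ p) 0 R := by
    refine Real.circleAverage_mono ((i3.const_smul).add (i1.const_smul)) i2 fun z hz => ?_
    have := mul_le_mul_of_nonneg_left (rpow_tangent_le hp h0 (norm_nonneg (F z))) (hnn z hz)
    refine le_of_eq_of_le ?_ this
    simp only [Pi.add_apply, Pi.smul_apply, smul_eq_mul]
    rw [hc]; ring
  rw [Real.circleAverage_add i3.const_smul i1.const_smul, Real.circleAverage_smul,
    Real.circleAverage_smul, circleAverage_poissonKernel hw, smul_eq_mul, smul_eq_mul] at h2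
  nlinarith [mul_le_mul_of_nonneg_left h1 hc0]

theorem diffContOnCl_ball_of_lt_one {F : ℂ → ℂ} (hF : DifferentiableOn ℂ F (Metric.ball 0 1))
    {R : ℝ} (hR : R ∈ Ioo (0 : ℝ) 1) : DiffContOnCl ℂ F (Metric.ball 0 R) := by
  refine (hF.mono ?_).diffContOnCl
  rw [closure_ball 0 hR.1.ne']
  exact Metric.closedBall_subset_ball hR.2

/-- Growth of functions in `H^p`: `|f(w)| ≤ (2 / (1 - |w|)) ^ (1/p) ‖f‖`, in terms of `p`-th powers.
The Poisson kernel of the circle of radius `R` is at most `2 / (R - |w|)`, and `R` tends to `1`. -/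
theorem HardySpace.norm_apply_rpow_mul_le (f : HardySpace p hp) {w : ℂ} (hw : ‖w‖ < 1) :
    ‖extZero f.1 w‖ ^ p * (1 - ‖w‖) ≤ 2 * ‖f‖ ^ p := by
  have hp0 : 0 < p := by linarith
  have key : ∀ R ∈ Ioo ‖w‖ 1, ‖extZero f.1 w‖ ^ p * (R - ‖w‖) ≤ 2 * ‖f‖ ^ p := by
    intro R hR
    have hR' : R ∈ Ioo (0 : ℝ) 1 := ⟨(norm_nonneg _).trans_lt hR.1, hR.2⟩
    have hpos : 0 < R - ‖w‖ := sub_pos.2 hR.1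
    rw [← le_div_iff₀ hpos]
    refine (norm_rpow_le_circleAverage hp (diffContOnCl_ball_of_lt_one f.2.1 hR') hR.1).trans ?_
    have hsub := sphere_subset_unitBall hR'
    have hFc : ContinuousOn (extZero f.1) (Metric.sphere 0 R) := f.2.1.continuousOn.mono hsub
    have h1 : Real.circleAverage (fun z => poissonKernel 0 w z * ‖extZero f.1 z‖ ^ p) 0 R ≤
        Real.circleAverage (fun z => (2 / (R - ‖w‖)) • ‖extZero f.1 z‖ ^ p) 0 R := by
      refine Real.circleAverage_mono (ContinuousOn.circleIntegrable hR'.1.le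
        ((continuousOn_poissonKernel_sphere hR.1).mul
          (hFc.norm.rpow_const fun _ _ => Or.inr hp0.le)))
        (circleIntegrable_norm_rpow hp0.le f.2.1.continuousOn hR').const_smul fun z hz => ?_
      rw [abs_of_pos hR'.1] at hz
      have h2 : poissonKernel 0 w z ≤ (R + ‖w - 0‖) / (R - ‖w - 0‖) := by
        rw [poissonKernel_eq_re_herglotzRieszKernel]
        exact re_herglotzRieszKernel_le hz (by simpa using hR.1)
      rw [sub_zero] at h2
      have h3 : (R + ‖w‖) / (R - ‖w‖) ≤ 2 / (R - ‖w‖) := by gcongr; linarith [hR.2, hR.1]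
      exact mul_le_mul_of_nonneg_right (h2.trans h3) (by positivity)
    refine h1.trans ?_
    rw [Real.circleAverage_fun_smul, smul_eq_mul, div_mul_eq_mul_div]
    gcongr
    exact f.powMean_le hR'
  have hev : ∀ᶠ R in 𝓝[<] (1 : ℝ), ‖extZero f.1 w‖ ^ p * (R - ‖w‖) ≤ 2 * ‖f‖ ^ p := by
    filter_upwards [Ioo_mem_nhdsLT hw] with R hR using key R hR
  refine le_of_tendsto (Tendsto.mono_left ?_ nhdsWithin_le_nhds) hev
  exact (Continuous.tendsto (by fun_prop) 1)

/-- Exchanging the arguments of the two points does not change the Poisson kernel. -/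
theorem poissonKernel_symm_circleMap (r R θ φ : ℝ) :
    poissonKernel 0 (circleMap 0 r θ) (circleMap 0 R φ) =
      poissonKernel 0 (circleMap 0 r φ) (circleMap 0 R θ) := by
  have h : ∀ a b : ℝ, ‖circleMap 0 R a - circleMap 0 r b‖ ^ 2 =
      R ^ 2 + r ^ 2 - 2 * R * r * Real.cos (a - b) := by
    intro a b
    rw [← normSq_eq_norm_sq, normSq_apply]
    simp only [circleMap_zero, sub_re, sub_im, mul_re, mul_im, ofReal_re, ofReal_im,
      exp_ofReal_mul_I_re, exp_ofReal_mul_I_im, Real.cos_sub]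
    linear_combination R ^ 2 * Real.sin_sq_add_cos_sq a + r ^ 2 * Real.sin_sq_add_cos_sq b
  simp only [poissonKernel_def, sub_zero, h, norm_circleMap_zero]
  rw [← Real.cos_neg (φ - θ), neg_sub]

/-- The integral means of a holomorphic function increase with the radius: integrate the Poisson
bound over the smaller circle and exchange the integrals. -/
theorem powMean_mono {p : ℝ} (hp : 1 ≤ p) {F : ℂ → ℂ}
    (hF : DifferentiableOn ℂ F (Metric.ball 0 1)) {r R : ℝ} (hr : r ∈ Ioo (0 : ℝ) 1)
    (hR : R ∈ Ioo (0 : ℝ) 1) (hrR : r ≤ R) : powMean p F r ≤ powMean p F R := by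
  have hp0 : 0 < p := by linarith
  rcases hrR.eq_or_lt with rfl | hlt
  · exact le_rfl
  have hcirc : ∀ {ρ : ℝ}, ρ ∈ Ioo (0 : ℝ) 1 → Continuous fun θ => ‖F (circleMap 0 ρ θ)‖ ^ p :=
    fun hρ => (hF.continuousOn.comp_continuous (continuous_circleMap 0 _) fun θ => by
      simp [abs_of_pos hρ.1, hρ.2]).norm.rpow_const fun _ => Or.inr hp0.le
  have hK : Continuous fun x : ℝ × ℝ =>
      poissonKernel 0 (circleMap 0 r x.1) (circleMap 0 R x.2) := by
    simp only [poissonKernel_def, sub_zero]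
    refine Continuous.div (by fun_prop) (by fun_prop) fun x h => ?_
    rw [sq_eq_zero_iff, norm_eq_zero, sub_eq_zero] at h
    have := congrArg norm h
    simp [abs_of_pos hr.1, abs_of_pos hR.1] at this
    linarith
  have hKF : Continuous fun x : ℝ × ℝ =>
      poissonKernel 0 (circleMap 0 r x.1) (circleMap 0 R x.2) * ‖F (circleMap 0 R x.2)‖ ^ p :=
    hK.mul ((hcirc hR).comp continuous_snd)
  have hpt : ∀ θ : ℝ, ‖F (circleMap 0 r θ)‖ ^ p ≤ (2 * Real.pi)⁻¹ * ∫ φ in (0)..(2 * Real.pi),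
      poissonKernel 0 (circleMap 0 r θ) (circleMap 0 R φ) * ‖F (circleMap 0 R φ)‖ ^ p := by
    intro θ
    have := norm_rpow_le_circleAverage hp (diffContOnCl_ball_of_lt_one hF hR)
      (w := circleMap 0 r θ) (by simpa [abs_of_pos hr.1] using hlt)
    rwa [Real.circleAverage_def, smul_eq_mul] at this
  have hone : ∀ φ : ℝ, (2 * Real.pi)⁻¹ * ∫ θ in (0)..(2 * Real.pi),
      poissonKernel 0 (circleMap 0 r θ) (circleMap 0 R φ) = 1 := by
    intro φ
    rw [← circleAverage_poissonKernel (w := circleMap 0 r φ) (R := R)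
      (by simpa [abs_of_pos hr.1] using hlt), Real.circleAverage_def, smul_eq_mul]
    simp only [poissonKernel_symm_circleMap r R _ φ]
  have hπ : (0 : ℝ) ≤ 2 * Real.pi := by positivity
  rw [powMean, powMean, Real.circleAverage_def, Real.circleAverage_def, smul_eq_mul, smul_eq_mul]
  refine mul_le_mul_of_nonneg_left ?_ (by positivity)
  calc ∫ θ in (0)..(2 * Real.pi), ‖F (circleMap 0 r θ)‖ ^ p
      ≤ ∫ θ in (0)..(2 * Real.pi), (2 * Real.pi)⁻¹ * ∫ φ in (0)..(2 * Real.pi),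
        poissonKernel 0 (circleMap 0 r θ) (circleMap 0 R φ) * ‖F (circleMap 0 R φ)‖ ^ p := by
        refine intervalIntegral.integral_mono hπ ((hcirc hr).intervalIntegrable _ _)
          (Continuous.intervalIntegrable ?_ _ _) hpt
        exact continuous_const.mul
          (intervalIntegral.continuous_parametric_intervalIntegral_of_continuous' hKF _ _)
    _ = ∫ φ in (0)..(2 * Real.pi), (2 * Real.pi)⁻¹ * ∫ θ in (0)..(2 * Real.pi),
        poissonKernel 0 (circleMap 0 r θ) (circleMap 0 R φ) * ‖F (circleMap 0 R φ)‖ ^ p := by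
        rw [intervalIntegral.integral_const_mul, intervalIntegral.integral_const_mul,
          intervalIntegral_intervalIntegral_swap]
        rw [uIoc_of_le hπ]
        exact (hKF.continuousOn.integrableOn_compact (isCompact_Icc.prod isCompact_Icc)).mono_set
          (prod_mono Ioc_subset_Icc_self Ioc_subset_Icc_self)
    _ = ∫ φ in (0)..(2 * Real.pi), ‖F (circleMap 0 R φ)‖ ^ p := by
        refine intervalIntegral.integral_congr fun φ _ => ?_
        simp only [intervalIntegral.integral_mul_const]
        rw [← mul_assoc, hone, one_mul]

/-! ### Uniform convexity of the `p`-th power means -/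

theorem norm_half_add_rpow_lt {p : ℝ} (hp : 1 < p) {a b : ℂ} (hab : a ≠ b) :
    ‖(a + b) / 2‖ ^ p < (‖a‖ ^ p + ‖b‖ ^ p) / 2 := by
  have hp0 : 0 < p := by linarith
  have hn : ‖(a + b) / 2‖ = ‖a + b‖ / 2 := by simp
  rw [hn]
  by_cases h : ‖a‖ = ‖b‖
  · have h1 := parallelogram_law_with_norm ℝ a b
    have h2 : 0 < ‖a - b‖ := norm_pos_iff.2 (sub_ne_zero.2 hab)
    have h3 : ‖a + b‖ / 2 < ‖b‖ := by
      rw [h] at h1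
      nlinarith [norm_nonneg (a + b), norm_nonneg b]
    rw [h, add_self_div_two]
    exact Real.rpow_lt_rpow (by positivity) h3 hp0
  · have h1 := (strictConvexOn_rpow hp).2 (norm_nonneg a) (norm_nonneg b) h
      (show (0 : ℝ) < 1 / 2 by norm_num) (show (0 : ℝ) < 1 / 2 by norm_num) (by norm_num)
    simp only [smul_eq_mul] at h1
    have h2 : ‖a + b‖ / 2 ≤ 1 / 2 * ‖a‖ + 1 / 2 * ‖b‖ := by linarith [norm_add_le a b]
    calc (‖a + b‖ / 2) ^ p ≤ (1 / 2 * ‖a‖ + 1 / 2 * ‖b‖) ^ p :=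
          Real.rpow_le_rpow (by positivity) h2 hp0.le
      _ < _ := h1
      _ = _ := by ring

/-- Uniform convexity of `|·|^p`, `1 < p`: the defect in the midpoint inequality controls
`|a - b|^p` up to a small multiple of `|a|^p + |b|^p`. By homogeneity, this is a compactness
statement on the set `|a|^p + |b|^p = 1`. -/
theorem exists_norm_sub_rpow_le {p : ℝ} (hp : 1 < p) {η : ℝ} (hη : 0 < η) :
    ∃ C : ℝ, 0 ≤ C ∧ ∀ a b : ℂ, ‖a - b‖ ^ p ≤ η * (‖a‖ ^ p + ‖b‖ ^ p) +
      C * ((‖a‖ ^ p + ‖b‖ ^ p) / 2 - ‖(a + b) / 2‖ ^ p) := by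
  have hp0 : 0 < p := by linarith
  have hc : ∀ {g : ℂ × ℂ → ℂ}, Continuous g → Continuous fun x => ‖g x‖ ^ p := fun hg =>
    hg.norm.rpow_const fun _ => Or.inr hp0.le
  have hcφ : Continuous fun x : ℂ × ℂ =>
      (‖x.1‖ ^ p + ‖x.2‖ ^ p) / 2 - ‖(x.1 + x.2) / 2‖ ^ p :=
    (((hc continuous_fst).add (hc continuous_snd)).div_const 2).sub (hc (by fun_prop))
  have hle1 : ∀ {x y : ℝ}, 0 ≤ x → 0 ≤ y → x ^ p + y ^ p = 1 → x ≤ 1 := by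
    intro x y hx hy h
    by_contra! h1
    have := Real.one_lt_rpow h1 hp0
    have : 0 ≤ y ^ p := by positivity
    linarith
  -- the normalized statement
  obtain ⟨C, hC0, hC⟩ : ∃ C : ℝ, 0 ≤ C ∧ ∀ a b : ℂ, ‖a‖ ^ p + ‖b‖ ^ p = 1 →
      ‖a - b‖ ^ p ≤ η + C * (1 / 2 - ‖(a + b) / 2‖ ^ p) := by
    let K : Set (ℂ × ℂ) := {x | ‖x.1‖ ^ p + ‖x.2‖ ^ p = 1 ∧ η ≤ ‖x.1 - x.2‖ ^ p}
    have hK : IsCompact K := by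
      refine Metric.isCompact_of_isClosed_isBounded ?_ ?_
      · exact (isClosed_eq ((hc continuous_fst).add (hc continuous_snd)) continuous_const).inter
          (isClosed_le continuous_const (hc (by fun_prop)))
      · refine (Metric.isBounded_closedBall (x := (0 : ℂ × ℂ)) (r := 1)).subset fun x hx => ?_
        rw [mem_closedBall_zero_iff, Prod.norm_def]
        exact max_le (hle1 (norm_nonneg _) (norm_nonneg _) hx.1)
          (hle1 (norm_nonneg _) (norm_nonneg _) ((add_comm _ _).trans hx.1))
    have hnn : ∀ a b : ℂ, ‖a‖ ^ p + ‖b‖ ^ p = 1 → 0 ≤ 1 / 2 - ‖(a + b) / 2‖ ^ p := by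
      intro a b h
      rcases eq_or_ne a b with rfl | hab
      · rw [add_self_div_two]; linarith
      · have := norm_half_add_rpow_lt hp hab
        rw [h] at this; linarith
    rcases K.eq_empty_or_nonempty with hKe | hKn
    · refine ⟨0, le_rfl, fun a b h => ?_⟩
      by_contra! h1
      have : (a, b) ∈ K := ⟨h, by linarith⟩
      simp [hKe] at this
    · obtain ⟨x, hx, hmin⟩ := hK.exists_isMinOn hKn hcφ.continuousOn
      set m := (‖x.1‖ ^ p + ‖x.2‖ ^ p) / 2 - ‖(x.1 + x.2) / 2‖ ^ p with hm
      have hm0 : 0 < m := by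
        refine sub_pos.2 (norm_half_add_rpow_lt hp fun h => ?_)
        have := hx.2
        rw [h, sub_self, norm_zero, Real.zero_rpow hp0.ne'] at this
        linarith
      refine ⟨2 ^ p / m, by positivity, fun a b h => ?_⟩
      have h0 := hnn a b h
      by_cases hab : η ≤ ‖a - b‖ ^ p
      · have h1 : m ≤ (‖a‖ ^ p + ‖b‖ ^ p) / 2 - ‖(a + b) / 2‖ ^ p := hmin (a := (a, b)) ⟨h, hab⟩
        rw [h] at h1
        have h2 : ‖a - b‖ ^ p ≤ 2 ^ p := by
          refine Real.rpow_le_rpow (norm_nonneg _) ?_ hp0.le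
          have := hle1 (norm_nonneg a) (norm_nonneg b) h
          have := hle1 (norm_nonneg b) (norm_nonneg a) ((add_comm _ _).trans h)
          linarith [norm_sub_le a b]
        have h3 : 2 ^ p ≤ 2 ^ p / m * (1 / 2 - ‖(a + b) / 2‖ ^ p) := by
          rw [div_mul_eq_mul_div, le_div_iff₀ hm0]
          gcongr
        linarith
      · have : 0 ≤ 2 ^ p / m * (1 / 2 - ‖(a + b) / 2‖ ^ p) := by positivity
        linarith
  refine ⟨C, hC0, fun a b => ?_⟩
  set T := ‖a‖ ^ p + ‖b‖ ^ p with hT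
  have hT0 : 0 ≤ T := by positivity
  rcases hT0.eq_or_lt with h0 | h0
  · have ha : ‖a‖ ^ p = 0 := by
      have : 0 ≤ ‖a‖ ^ p := by positivity
      have : 0 ≤ ‖b‖ ^ p := by positivity
      linarith
    have hb : ‖b‖ ^ p = 0 := by linarith
    rw [Real.rpow_eq_zero (norm_nonneg _) hp0.ne', norm_eq_zero] at ha hb
    simp [ha, hb, ← h0, Real.zero_rpow hp0.ne']
  · set t := T ^ p⁻¹ with ht
    have ht0 : 0 < t := by positivity
    have htp : t ^ p = T := Real.rpow_inv_rpow hT0 hp0.ne'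
    have hs : ∀ c : ℂ, ‖c / t‖ ^ p = ‖c‖ ^ p / T := by
      intro c
      rw [norm_div, Complex.norm_real, Real.norm_of_nonneg ht0.le,
        Real.div_rpow (norm_nonneg _) ht0.le, htp]
    have h := hC (a / t) (b / t) (by rw [hs, hs, ← add_div, ← hT, div_self h0.ne'])
    rw [← sub_div, ← add_div, div_right_comm, hs, hs, div_le_iff₀ h0] at h
    refine h.trans_eq ?_
    field_simp

/-! ### Density of the polynomials in the Hardy space -/

theorem powMean_comp_mul (p : ℝ) (F : ℂ → ℂ) (r ρ : ℝ) :
    powMean p (fun z => F (r * z)) ρ = powMean p F (r * ρ) := by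
  simp only [powMean, Real.circleAverage_def, circleMap_zero]
  push_cast
  simp only [mul_assoc]

theorem mul_mem_unitBall {r : ℝ} (hr : r ∈ Ioo (0 : ℝ) 1) {z : ℂ}
    (hz : z ∈ Metric.ball (0 : ℂ) 1) : (r : ℂ) * z ∈ Metric.ball (0 : ℂ) 1 := by
  rw [mem_ball_zero_iff] at *
  rw [norm_mul, Complex.norm_real, Real.norm_of_nonneg hr.1.le]
  nlinarith [hr.1, hr.2, norm_nonneg z]

theorem differentiableOn_dilate {F : ℂ → ℂ} (hF : DifferentiableOn ℂ F (Metric.ball 0 1)) {r : ℝ}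
    (hr : r ∈ Ioo (0 : ℝ) 1) : DifferentiableOn ℂ (fun z => F (r * z)) (Metric.ball 0 1) :=
  hF.comp (by fun_prop) fun _ hz => mul_mem_unitBall hr hz

theorem mul_mem_Ioo {r ρ : ℝ} (hr : r ∈ Ioo (0 : ℝ) 1) (hρ : ρ ∈ Ioo (0 : ℝ) 1) :
    r * ρ ∈ Ioo (0 : ℝ) 1 :=
  ⟨mul_pos hr.1 hρ.1, mul_lt_one_of_nonneg_of_lt_one_left hr.1.le hr.2 hρ.2.le⟩

/-- Integrated form of `exists_norm_sub_rpow_le`. -/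
theorem powMean_sub_le {p : ℝ} (hp : 0 ≤ p) {η C : ℝ}
    (h : ∀ a b : ℂ, ‖a - b‖ ^ p ≤ η * (‖a‖ ^ p + ‖b‖ ^ p) +
      C * ((‖a‖ ^ p + ‖b‖ ^ p) / 2 - ‖(a + b) / 2‖ ^ p)) {F G : ℂ → ℂ}
    (hF : ContinuousOn F (Metric.ball 0 1)) (hG : ContinuousOn G (Metric.ball 0 1)) {r : ℝ}
    (hr : r ∈ Ioo (0 : ℝ) 1) :
    powMean p (fun z => F z - G z) r ≤ η * (powMean p F r + powMean p G r) +
      C * ((powMean p F r + powMean p G r) / 2 - powMean p (fun z => (F z + G z) / 2) r) := by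
  have iF := circleIntegrable_norm_rpow hp hF hr
  have iG := circleIntegrable_norm_rpow hp hG hr
  have iS : CircleIntegrable (fun z => ‖(F z + G z) / 2‖ ^ p) 0 r :=
    circleIntegrable_norm_rpow hp ((hF.add hG).div_const 2) hr
  have iD : CircleIntegrable (fun z => ‖F z - G z‖ ^ p) 0 r :=
    circleIntegrable_norm_rpow hp (hF.sub hG) hr
  have iR : CircleIntegrable ((η + C / 2) • (fun z => ‖F z‖ ^ p) + ((η + C / 2) •
      (fun z => ‖G z‖ ^ p) + (-C) • fun z => ‖(F z + G z) / 2‖ ^ p)) 0 r :=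
    iF.const_smul.add (iG.const_smul.add iS.const_smul)
  have key := Real.circleAverage_mono iD iR fun z _ => by
    refine (h (F z) (G z)).trans_eq ?_
    simp only [Pi.add_apply, Pi.smul_apply, smul_eq_mul]
    ring
  rw [Real.circleAverage_add iF.const_smul (iG.const_smul.add iS.const_smul),
    Real.circleAverage_add iG.const_smul iS.const_smul, Real.circleAverage_smul,
    Real.circleAverage_smul, Real.circleAverage_smul] at key
  refine key.trans_eq ?_
  simp only [powMean, smul_eq_mul]
  ring

/-- On a fixed circle, the mean of the midpoint of `F` and its dilation `F(r ·)` tends to the mean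
of `F` as `r → 1`. -/
theorem exists_dilation_midpoint_mean_gt {p : ℝ} (hp : 0 < p) {F : ℂ → ℂ}
    (hF : ContinuousOn F (Metric.ball 0 1)) {ρ : ℝ} (hρ : ρ ∈ Ioo (0 : ℝ) 1) {a : ℝ}
    (ha : a < powMean p F ρ) :
    ∃ r ∈ Ioo (0 : ℝ) 1, a < powMean p (fun z => (F (r * z) + F z) / 2) ρ := by
  -- the clamped radius makes the integrand continuous in all real parameters
  let Φ : ℝ → ℝ → ℝ := fun r θ =>
    ‖(F ((max 0 (min r 1) : ℝ) * circleMap 0 ρ θ) + F (circleMap 0 ρ θ)) / 2‖ ^ p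
  have hball : ∀ x : ℝ × ℝ,
      ((max 0 (min x.1 1) : ℝ) : ℂ) * circleMap 0 ρ x.2 ∈ Metric.ball (0 : ℂ) 1 := by
    intro x
    have h0 : 0 ≤ max 0 (min x.1 1) := le_max_left _ _
    have h1 : max 0 (min x.1 1) ≤ 1 := max_le zero_le_one (min_le_right _ _)
    rw [mem_ball_zero_iff, norm_mul, Complex.norm_real, Real.norm_of_nonneg h0,
      norm_circleMap_zero, abs_of_pos hρ.1]
    nlinarith [hρ.1, hρ.2]
  have hΦ : Continuous (Function.uncurry Φ) := by
    refine Continuous.rpow_const (Continuous.norm ?_) fun _ => Or.inr hp.le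
    refine ((hF.comp_continuous (by fun_prop) hball).add
      (hF.comp_continuous (by fun_prop) fun x => ?_)).div_const 2
    simp [abs_of_pos hρ.1, hρ.2]
  have hcont := (intervalIntegral.continuous_parametric_intervalIntegral_of_continuous'
    (μ := volume) hΦ 0 (2 * Real.pi)).const_smul (2 * Real.pi)⁻¹
  have hval : ∀ r ∈ Ioc (0 : ℝ) 1, (2 * Real.pi)⁻¹ • ∫ θ in (0)..(2 * Real.pi), Φ r θ =
      powMean p (fun z => (F (r * z) + F z) / 2) ρ := by
    intro r hr
    simp only [powMean, Real.circleAverage_def, Φ, min_eq_left hr.2, max_eq_right hr.1.le]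
  have h1 : a < (2 * Real.pi)⁻¹ • ∫ θ in (0)..(2 * Real.pi), Φ 1 θ := by
    rw [hval 1 (by simp)]
    simpa only [ofReal_one, one_mul, add_self_div_two] using ha
  have hev : ∀ᶠ r in 𝓝[<] (1 : ℝ), a < (2 * Real.pi)⁻¹ • ∫ θ in (0)..(2 * Real.pi), Φ r θ :=
    (hcont.continuousAt.eventually (lt_mem_nhds h1)).filter_mono nhdsWithin_le_nhds
  obtain ⟨r, hr, hr2⟩ := (hev.and (Ioo_mem_nhdsLT (zero_lt_one' ℝ))).exists
  exact ⟨r, hr2, by rwa [hval r ⟨hr2.1, hr2.2.le⟩] at hr⟩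

/-- The dilations of `f ∈ H^p`, `1 < p`, come arbitrarily close to `f`. The midpoint of `f` and of
a dilation has a mean near `‖f‖^p` on some circle, hence on all larger circles, so that uniform
convexity bounds the distance there; monotonicity of the means does the rest. -/
theorem HardySpace.exists_dilation_powMean_le (hp1 : 1 < p) (f : HardySpace p hp) {ε : ℝ}
    (hε : 0 < ε) : ∃ r ∈ Ioo (0 : ℝ) 1, ∀ ρ ∈ Ioo (0 : ℝ) 1,
      powMean p (fun z => extZero f.1 (r * z) - extZero f.1 z) ρ ≤ ε := by
  have hp0 : 0 < p := by linarith
  set F := extZero f.1 with hFdef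
  have hF : DifferentiableOn ℂ F (Metric.ball 0 1) := f.2.1
  -- `η` and `δ` make each of the two terms of `powMean_sub_le` at most `ε / 2`
  set A := ‖f‖ ^ p with hA
  have hA0 : 0 ≤ A := by positivity
  set η := ε / (4 * (A + 1)) with hη
  obtain ⟨C, hC0, hC⟩ := exists_norm_sub_rpow_le hp1 (η := η) (by positivity)
  set δ := ε / (2 * (C + 1)) with hδ
  have hδ0 : 0 < δ := by positivity
  obtain ⟨ρ₀, hρ₀, hlt⟩ := f.exists_lt_powMean (a := A - δ) (by linarith)
  obtain ⟨r, hr, hmid⟩ := exists_dilation_midpoint_mean_gt hp0 hF.continuousOn hρ₀ hlt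
  have hFr := differentiableOn_dilate hF hr
  refine ⟨r, hr, fun ρ hρ => ?_⟩
  have hρ' : max ρ ρ₀ ∈ Ioo (0 : ℝ) 1 := ⟨lt_max_of_lt_left hρ.1, max_lt hρ.2 hρ₀.2⟩
  refine (powMean_mono hp (hFr.sub hF) hρ hρ' (le_max_left _ _)).trans ?_
  refine (powMean_sub_le hp0.le hC hFr.continuousOn hF.continuousOn hρ').trans ?_
  have m1 : powMean p (fun z => F (r * z)) (max ρ ρ₀) ≤ A := by
    rw [powMean_comp_mul]; exact f.powMean_le (mul_mem_Ioo hr hρ')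
  have m2 : powMean p F (max ρ ρ₀) ≤ A := f.powMean_le hρ'
  have m3 := hmid.trans_le (powMean_mono hp ((hFr.add hF).div_const 2) hρ₀ hρ' (le_max_right ρ ρ₀))
  simp only [Pi.add_apply] at m3
  have h1 : η * (powMean p (fun z => F (r * z)) (max ρ ρ₀) + powMean p F (max ρ ρ₀)) ≤ ε / 2 := by
    have : η * (powMean p (fun z => F (r * z)) (max ρ ρ₀) + powMean p F (max ρ ρ₀)) ≤
        η * (2 * (A + 1)) := by gcongr; linarith
    refine this.trans_eq ?_
    rw [hη]; field_simp; norm_num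
  have h2 : C * ((powMean p (fun z => F (r * z)) (max ρ ρ₀) + powMean p F (max ρ ρ₀)) / 2 -
      powMean p (fun z => (F (r * z) + F z) / 2) (max ρ ρ₀)) ≤ ε / 2 := by
    have : C * ((powMean p (fun z => F (r * z)) (max ρ ρ₀) + powMean p F (max ρ ρ₀)) / 2 -
        powMean p (fun z => (F (r * z) + F z) / 2) (max ρ ρ₀)) ≤ C * δ :=
      mul_le_mul_of_nonneg_left (by linarith) hC0
    refine this.trans ?_
    have : C * δ ≤ (C + 1) * δ := by gcongr; linarith
    refine this.trans_eq ?_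
    rw [hδ]; field_simp
  linarith

/-- A holomorphic function on the unit disc is a uniform limit of polynomials on every smaller
disc. -/
theorem exists_polynomial_near {F : ℂ → ℂ} (hF : DifferentiableOn ℂ F (Metric.ball 0 1)) {r : ℝ}
    (hr : r ∈ Ioo (0 : ℝ) 1) {ε : ℝ} (hε : 0 < ε) :
    ∃ (n : ℕ) (c : ℕ → ℂ), ∀ z ∈ Metric.ball (0 : ℂ) 1,
      ‖F (r * z) - ∑ k ∈ Finset.range n, c k * z ^ k‖ < ε := by
  obtain ⟨R, hR⟩ := exists_between hr.2
  have hR0 : 0 < R := hr.1.trans hR.1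
  lift R to NNReal using hR0.le
  have hps := (hF.mono (Metric.closedBall_subset_ball (x := (0 : ℂ)) hR.2)).hasFPowerSeriesOnBall
    (by exact_mod_cast hR0)
  have hu := hps.tendstoUniformlyOn (r' := r.toNNReal)
    (by rw [ENNReal.coe_lt_coe, ← NNReal.coe_lt_coe, Real.coe_toNNReal r hr.1.le]; exact hR.1)
  rw [Metric.tendstoUniformlyOn_iff] at hu
  obtain ⟨n, hn⟩ := (hu ε hε).exists
  refine ⟨n, fun k => r ^ k * (cauchyPowerSeries F 0 R).coeff k, fun z hz => ?_⟩
  have h := hn (r * z) (by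
    rw [mem_ball_zero_iff] at *
    rw [norm_mul, Complex.norm_real, Real.norm_of_nonneg hr.1.le, Real.coe_toNNReal r hr.1.le]
    nlinarith [hr.1])
  rw [zero_add, dist_eq_norm, FormalMultilinearSeries.partialSum] at h
  refine lt_of_eq_of_lt (congrArg norm (congrArg₂ _ rfl (Finset.sum_congr rfl fun k _ => ?_))) h
  rw [FormalMultilinearSeries.apply_eq_pow_smul_coeff, smul_eq_mul]
  ring

theorem pow_bound (hp : 1 ≤ p) (n : ℕ) (r : ℝ) (hr : r ∈ Ioo (0 : ℝ) 1) :
    powMean p (fun z => z ^ n) r ≤ 1 ^ p :=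
  powMean_le_of_norm_le (by linarith) (by fun_prop) (fun z hz => by
    rw [norm_pow]
    exact pow_le_one₀ (norm_nonneg _) (by simpa using (mem_ball_zero_iff.1 hz).le)) hr

/-- The monomial `z ^ n` as an element of `H^p`. -/
def HardySpace.monomial (p : ℝ) (hp : 1 ≤ p) (n : ℕ) : HardySpace p hp :=
  HardySpace.ofBound hp (fun z => z ^ n) (by fun_prop) 1 zero_le_one (pow_bound hp n)

/-- The inclusion of `H^p` into the functions on the disc. -/
def HardySpace.toFunₗ (p : ℝ) (hp : 1 ≤ p) : HardySpace p hp →ₗ[ℂ] (𝔻 → ℂ) :=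
  (hardySubmodule p hp).subtype

/-- A subspace of `H^p`, `1 < p`, that contains all monomials is dense. -/
theorem HardySpace.dense_of_monomial_mem (hp1 : 1 < p) (S : Submodule ℂ (HardySpace p hp))
    (hS : ∀ n, HardySpace.monomial p hp n ∈ S) : Dense (S : Set (HardySpace p hp)) := by
  have hp0 : 0 < p := by linarith
  intro f
  refine Metric.mem_closure_iff.2 fun ε hε => ?_
  obtain ⟨r, hr, hdil⟩ := f.exists_dilation_powMean_le hp1 (ε := (ε / 3) ^ p) (by positivity)
  obtain ⟨n, c, hpoly⟩ := exists_polynomial_near f.2.1 hr (ε := ε / 3) (by positivity)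
  set q : HardySpace p hp := ∑ k ∈ Finset.range n, c k • HardySpace.monomial p hp k with hq
  have hqapply : ∀ z : 𝔻, q z = ∑ k ∈ Finset.range n, c k * (z : ℂ) ^ k := by
    intro z
    change HardySpace.toFunₗ p hp q z = _
    rw [hq, map_sum, Finset.sum_apply]
    rfl
  refine ⟨q, Submodule.sum_mem _ fun k _ => S.smul_mem _ (hS k), ?_⟩
  -- the dilation `g` of `f` is close to `f` in norm and to the polynomial `q` uniformly
  set g : HardySpace p hp := HardySpace.ofBound hp (fun z => extZero f.1 (r * z))
    (differentiableOn_dilate f.2.1 hr) ‖f‖ (norm_nonneg _) (fun ρ hρ => by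
      rw [powMean_comp_mul]; exact f.powMean_le (mul_mem_Ioo hr hρ)) with hg
  have hgapply : ∀ z : 𝔻, g z = extZero f.1 (r * z) := fun z => rfl
  have hext : ∀ u v : HardySpace p hp, ∀ z (hz : z ∈ Metric.ball (0 : ℂ) 1),
      extZero (u - v).1 z = u (UnitDisc.mk z (by simpa using hz)) -
        v (UnitDisc.mk z (by simpa using hz)) := fun u v z hz =>
    extZero_of_norm_lt (u - v).1 (by simpa using hz)
  have d1 : ‖g - f‖ ≤ ε / 3 := by
    refine HardySpace.norm_le_of_powMean_le _ (by positivity) fun ρ hρ => ?_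
    refine (powMean_congr p hρ fun z hz => ?_).trans_le (hdil ρ hρ)
    rw [hext g f z hz, hgapply, ← extZero_coe f.1]; rfl
  have d2 : ‖g - q‖ ≤ ε / 3 := by
    refine HardySpace.norm_le_of_powMean_le _ (by positivity) fun ρ hρ =>
      powMean_le_of_norm_le hp0.le (g - q).2.1.continuousOn (fun z hz => ?_) hρ
    rw [hext g q z hz, hgapply, hqapply]
    exact (hpoly z hz).le
  rw [dist_eq_norm]
  have : f - q = (g - q) - (g - f) := by abel
  rw [this]
  linarith [norm_sub_le (g - q) (g - f)]

/-! ### The semigroup `f ↦ (1 + z + ⋯ + z^(n-1)) f(z^n)` -/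

/-- The map `z ↦ z ^ n` wraps the circle of radius `r` uniformly `n` times around the circle of
radius `r ^ n`. -/
theorem powMean_comp_pow {p : ℝ} (hp : 0 ≤ p) {F : ℂ → ℂ} (hF : ContinuousOn F (Metric.ball 0 1))
    {n : ℕ} (hn : n ≠ 0) {r : ℝ} (hr : r ∈ Ioo (0 : ℝ) 1) :
    powMean p (fun z => F (z ^ n)) r = powMean p F (r ^ n) := by
  have hrn : r ^ n ∈ Ioo (0 : ℝ) 1 := ⟨pow_pos hr.1 n, pow_lt_one₀ hr.1.le hr.2 hn⟩
  set g : ℝ → ℝ := fun θ => ‖F (circleMap 0 (r ^ n) θ)‖ ^ p with hg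
  have hgc : Continuous g := (hF.comp_continuous (continuous_circleMap 0 _) fun θ => by
    rw [mem_ball_zero_iff, norm_circleMap_zero, abs_of_pos hrn.1]
    exact hrn.2).norm.rpow_const fun _ => Or.inr hp
  have hper : Function.Periodic g (2 * Real.pi) := fun θ => by
    simp only [hg, periodic_circleMap 0 (r ^ n) θ]
  have hpow : ∀ θ : ℝ, circleMap 0 r θ ^ n = circleMap 0 (r ^ n) (n * θ) := by
    intro θ
    simp only [circleMap_zero, mul_pow, ← Complex.exp_nat_mul]
    push_cast
    ring_nf
  have hn0 : (n : ℝ) ≠ 0 := by exact_mod_cast hn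
  have h1 := hper.intervalIntegral_add_zsmul_eq n 0 fun _ _ => hgc.intervalIntegrable _ _
  simp only [zero_add, natCast_zsmul, nsmul_eq_mul] at h1
  simp only [powMean, Real.circleAverage_def, hpow]
  congr 1
  change ∫ θ in (0)..(2 * Real.pi), g (n * θ) = _
  rw [intervalIntegral.integral_comp_mul_left g hn0, mul_zero, h1, smul_eq_mul,
    inv_mul_cancel_left₀ hn0]

theorem pow_mem_unitBall {n : ℕ} (hn : n ≠ 0) {z : ℂ} (hz : z ∈ Metric.ball (0 : ℂ) 1) :
    z ^ n ∈ Metric.ball (0 : ℂ) 1 := by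
  rw [mem_ball_zero_iff] at *
  rw [norm_pow]
  exact pow_lt_one₀ (norm_nonneg _) hz hn

theorem differentiableOn_powSubst {F : ℂ → ℂ} (hF : DifferentiableOn ℂ F (Metric.ball 0 1))
    {n : ℕ} (hn : n ≠ 0) : DifferentiableOn ℂ
      (fun z => (∑ j ∈ Finset.range n, z ^ j) * F (z ^ n)) (Metric.ball 0 1) :=
  DifferentiableOn.mul (by fun_prop) (hF.comp (by fun_prop) fun _ hz => pow_mem_unitBall hn hz)

theorem norm_geom_sum_le (n : ℕ) {z : ℂ} (hz : ‖z‖ ≤ 1) :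
    ‖∑ j ∈ Finset.range n, z ^ j‖ ≤ n := by
  refine (norm_sum_le_of_le _ (f := fun j => z ^ j) (n := fun _ => 1) fun j _ => ?_).trans_eq
    (by simp)
  rw [norm_pow]
  exact pow_le_one₀ (norm_nonneg _) hz

theorem HardySpace.powMean_powSubst_le (f : HardySpace p hp) {n : ℕ} (hn : n ≠ 0) (r : ℝ)
    (hr : r ∈ Ioo (0 : ℝ) 1) :
    powMean p (fun z => (∑ j ∈ Finset.range n, z ^ j) * extZero f.1 (z ^ n)) r ≤
      (n * ‖f‖) ^ p := by
  have hp0 : 0 ≤ p := by linarith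
  have hFn : ContinuousOn (fun z => extZero f.1 (z ^ n)) (Metric.ball 0 1) :=
    f.2.1.continuousOn.comp (by fun_prop) fun _ hz => pow_mem_unitBall hn hz
  have h1 : powMean p (fun z => (∑ j ∈ Finset.range n, z ^ j) * extZero f.1 (z ^ n)) r ≤
      powMean p (fun z => (n : ℂ) * extZero f.1 (z ^ n)) r := by
    refine powMean_le_powMean hp0 hr (differentiableOn_powSubst f.2.1 hn).continuousOn
      (continuousOn_const.mul hFn) fun z hz => ?_
    rw [norm_mul, norm_mul, Complex.norm_natCast]
    refine mul_le_mul_of_nonneg_right (norm_geom_sum_le n ?_) (norm_nonneg _)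
    simpa using (mem_ball_zero_iff.1 (sphere_subset_unitBall hr hz)).le
  have h2 : powMean p (fun z => (n : ℂ) * extZero f.1 (z ^ n)) r =
      (n : ℝ) ^ p * powMean p (fun z => extZero f.1 (z ^ n)) r := by
    rw [powMean, powMean, ← smul_eq_mul, ← Real.circleAverage_fun_smul]
    simp only [norm_mul, Complex.norm_natCast, smul_eq_mul,
      Real.mul_rpow (Nat.cast_nonneg n) (norm_nonneg _)]
  rw [h2, powMean_comp_pow hp0 f.2.1.continuousOn hn hr] at h1
  refine h1.trans ?_
  rw [Real.mul_rpow (Nat.cast_nonneg n) (norm_nonneg _)]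
  gcongr
  exact f.powMean_le ⟨pow_pos hr.1 n, pow_lt_one₀ hr.1.le hr.2 hn⟩

/-- The operator `W_n f(z) = (1 + z + ⋯ + z^(n-1)) f(z^n)` on `H^p`. -/
noncomputable def powSubst (p : ℝ) (hp : 1 ≤ p) (n : ℕ) (hn : n ≠ 0) :
    HardySpace p hp →L[ℂ] HardySpace p hp :=
  LinearMap.mkContinuous
    { toFun := fun f => HardySpace.ofBound hp
        (fun z => (∑ j ∈ Finset.range n, z ^ j) * extZero f.1 (z ^ n))
        (differentiableOn_powSubst f.2.1 hn) (n * ‖f‖) (by positivity) (f.powMean_powSubst_le hn)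
      map_add' := fun f g => Subtype.ext (funext fun z => by
        change _ * extZero (f.1 + g.1) _ = _ * extZero f.1 _ + _ * extZero g.1 _
        rw [extZero_add, Pi.add_apply, mul_add])
      map_smul' := fun c f => Subtype.ext (funext fun z => by
        change _ * extZero (c • f.1) _ = c • (_ * extZero f.1 _)
        rw [extZero_smul, Pi.smul_apply, smul_eq_mul, smul_eq_mul, mul_left_comm]) }
    n fun f => HardySpace.norm_ofBound_le _ (differentiableOn_powSubst f.2.1 hn) _
      (by positivity) (f.powMean_powSubst_le hn)

theorem hFun_eq {k : ℕ} (hk : k ≠ 0) (z : 𝔻) : hFun k z = 1 / (k : ℂ) * (1 / (1 - (z : ℂ))) *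
    (log (1 - (z : ℂ) ^ k) - log (1 - (z : ℂ)) - log (k : ℂ)) := by
  rw [hFun, log_geom hk z.norm_lt_one]

/-- The logarithms in `h_{nk}` and `h_n` telescope: `W_n h_k = n h_{nk} - (n/k) h_n`. -/
theorem powSubst_hElem (hp2 : p ≤ 2) {n k : ℕ} (hn : n ≠ 0) (hk : k ≠ 0) :
    powSubst p hp n hn (hElem p hp hp2 k) =
      (n : ℂ) • hElem p hp hp2 (n * k) - ((n : ℂ) / k) • hElem p hp hp2 n := by
  refine Subtype.ext (funext fun z => ?_)
  have hzn : ‖(z : ℂ) ^ n‖ < 1 := by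
    simpa using pow_mem_unitBall hn (mem_ball_zero_iff.2 z.norm_lt_one)
  change (∑ j ∈ Finset.range n, (z : ℂ) ^ j) * extZero (hFun k) ((z : ℂ) ^ n) =
    (n : ℂ) * hFun (n * k) z - ((n : ℂ) / k) * hFun n z
  rw [extZero_of_norm_lt _ hzn, hFun_eq hk, hFun_eq hn, hFun_eq (mul_ne_zero hn hk),
    UnitDisc.coe_mk, ← pow_mul]
  have hz0 : 1 - (z : ℂ) ≠ 0 := fun h => by simpa [h] using one_sub_re_pos z.norm_lt_one
  have hzn0 : 1 - (z : ℂ) ^ n ≠ 0 := fun h => by simpa [h] using one_sub_re_pos hzn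
  have hn0 : (n : ℂ) ≠ 0 := by exact_mod_cast hn
  have hk0 : (k : ℂ) ≠ 0 := by exact_mod_cast hk
  have hgeom : ∑ j ∈ Finset.range n, (z : ℂ) ^ j = (1 - (z : ℂ) ^ n) / (1 - z) := by
    rw [eq_div_iff hz0, mul_comm, mul_neg_geom_sum]
  have hlog : log ((n * k : ℕ) : ℂ) = log (n : ℂ) + log (k : ℂ) := by
    rw [← natCast_log, ← natCast_log, ← natCast_log, Nat.cast_mul,
      Real.log_mul (by exact_mod_cast hn) (by exact_mod_cast hk), ofReal_add]
  rw [hgeom, hlog]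
  push_cast
  field_simp
  ring

theorem closure_hSpan_powSubst_mem (hp2 : p ≤ 2) {n : ℕ} (hn : 2 ≤ n) {f : HardySpace p hp}
    (hf : f ∈ closure (hSpan p hp hp2 : Set (HardySpace p hp))) :
    powSubst p hp n (by omega) f ∈ closure (hSpan p hp hp2 : Set (HardySpace p hp)) := by
  refine map_mem_closure (powSubst p hp n (by omega)).continuous hf fun g hg => ?_
  have hle : hSpan p hp hp2 ≤
      (hSpan p hp hp2).comap (powSubst p hp n (by omega) : HardySpace p hp →ₗ[ℂ] _) := by
    refine Submodule.span_le.2 ?_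
    rintro _ ⟨k, hk, rfl⟩
    change powSubst p hp n (by omega) (hElem p hp hp2 k) ∈ hSpan p hp hp2
    rw [powSubst_hElem hp2 (by omega) (by omega)]
    refine Submodule.sub_mem _ (Submodule.smul_mem _ _ (Submodule.subset_span ⟨n * k, ?_, rfl⟩))
      (Submodule.smul_mem _ _ (Submodule.subset_span ⟨n, hn, rfl⟩))
    nlinarith
  exact hle hg

theorem powSubst_one_succ_sub {n : ℕ} (hn : n ≠ 0) :
    powSubst p hp (n + 1) n.succ_ne_zero 1 - powSubst p hp n hn 1 =
      HardySpace.monomial p hp n := by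
  refine Subtype.ext (funext fun z => ?_)
  have h1 : ∀ m : ℕ, m ≠ 0 → extZero (1 : HardySpace p hp).1 ((z : ℂ) ^ m) = 1 := fun m hm => by
    rw [extZero_of_norm_lt _ (by
      simpa using pow_mem_unitBall hm (mem_ball_zero_iff.2 z.norm_lt_one))]
    rfl
  change (∑ j ∈ Finset.range (n + 1), (z : ℂ) ^ j) * _ - (∑ j ∈ Finset.range n, (z : ℂ) ^ j) * _ =
    (z : ℂ) ^ n
  rw [h1 _ n.succ_ne_zero, h1 n hn, Finset.sum_range_succ]
  ring

theorem powSubst_one_eq (f : HardySpace p hp) : powSubst p hp 1 one_ne_zero f = f := by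
  refine Subtype.ext (funext fun z => ?_)
  change (∑ j ∈ Finset.range 1, (z : ℂ) ^ j) * extZero f.1 ((z : ℂ) ^ 1) = f.1 z
  simp [extZero_coe]

/-- The closed span of the `h_k` is invariant under the operators `powSubst`; if it contains `1`,
it contains every polynomial. -/
theorem dense_hSpan_of_one_mem_closure (hp1 : 1 < p) (hp2 : p ≤ 2)
    (h : (1 : HardySpace p hp) ∈ closure (hSpan p hp hp2 : Set (HardySpace p hp))) :
    Dense (hSpan p hp hp2 : Set (HardySpace p hp)) := by
  set M := (hSpan p hp hp2).topologicalClosure with hM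
  have hMc : (M : Set (HardySpace p hp)) = closure (hSpan p hp hp2 : Set (HardySpace p hp)) :=
    Submodule.topologicalClosure_coe _
  have hW : ∀ (n : ℕ) (hn : n ≠ 0), powSubst p hp n hn 1 ∈ M := by
    intro n hn
    rw [← SetLike.mem_coe, hMc]
    rcases (show n = 1 ∨ 2 ≤ n by omega) with rfl | h2
    · rwa [powSubst_one_eq]
    · exact closure_hSpan_powSubst_mem hp2 h2 h
  have hmono : ∀ n, HardySpace.monomial p hp n ∈ M := by
    intro n
    rcases eq_or_ne n 0 with rfl | hn
    · have : HardySpace.monomial p hp 0 = 1 := Subtype.ext (funext fun z => pow_zero _)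
      rw [this, ← SetLike.mem_coe, hMc]
      exact h
    · rw [← powSubst_one_succ_sub hn]
      exact M.sub_mem (hW _ _) (hW _ _)
  have := HardySpace.dense_of_monomial_mem hp1 M hmono
  rw [hMc] at this
  exact dense_closure.1 this

/-! ### The zeta function as a pairing with the coefficients of `h_k` -/

/-- The sequence `N ^ (1 - s)`, with value `0` at `N = 0` for every `s`. -/
noncomputable def zetaPow (s : ℂ) (N : ℕ) : ℂ := if N = 0 then 0 else (N : ℂ) ^ (1 - s)

theorem zetaPow_zero (s : ℂ) : zetaPow s 0 = 0 := if_pos rfl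

theorem zetaPow_succ (s : ℂ) (N : ℕ) : zetaPow s (N + 1) = ((N + 1 : ℕ) : ℂ) ^ (1 - s) :=
  if_neg N.succ_ne_zero

theorem norm_zetaPow_sub_le {s : ℂ} (hs : 0 < s.re) {N : ℕ} (hN : N ≠ 0) :
    ‖zetaPow s N - zetaPow s (N + 1)‖ ≤ ‖1 - s‖ * (N : ℝ) ^ (-s.re) := by
  have hNpos : (0 : ℝ) < N := by exact_mod_cast Nat.pos_of_ne_zero hN
  have hd : ∀ x ∈ Icc (N : ℝ) (N + 1), HasDerivWithinAt (fun x : ℝ => (x : ℂ) ^ (1 - s))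
      ((1 - s) * (x : ℂ) ^ (-s)) (Icc (N : ℝ) (N + 1)) x := by
    intro x hx
    have hx0 : 0 < x := hNpos.trans_le hx.1
    have := ((hasDerivAt_id (x : ℂ)).cpow_const (c := 1 - s)
      (ofReal_mem_slitPlane.2 hx0)).comp_ofReal.hasDerivWithinAt (s := Icc (N : ℝ) (N + 1))
    simpa using this
  have h := norm_image_sub_le_of_norm_deriv_le_segment' hd
    (C := ‖1 - s‖ * (N : ℝ) ^ (-s.re)) (fun x hx => ?_) (N + 1) (right_mem_Icc.2 (by linarith))
  · rw [zetaPow, zetaPow, if_neg hN, if_neg N.succ_ne_zero, norm_sub_rev]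
    simpa using h
  · have hx0 : 0 < x := hNpos.trans_le hx.1
    rw [norm_mul, Complex.norm_cpow_eq_rpow_re_of_pos hx0, neg_re]
    exact mul_le_mul_of_nonneg_left
      (Real.rpow_le_rpow_of_nonpos hNpos hx.1 (by linarith)) (norm_nonneg _)

/-- The terms of the pairing are dominated, uniformly on `δ ≤ re s`, `‖1 - s‖ ≤ R`. -/
theorem norm_hCoeff_mul_zetaPow_sub_le {k : ℕ} (hk : k ≠ 0) {δ R : ℝ} (hδ : 0 < δ) {s : ℂ}
    (hs : δ ≤ s.re) (hR : ‖1 - s‖ ≤ R) (N : ℕ) :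
    ‖(hCoeff k N : ℂ) * (zetaPow s N - zetaPow s (N + 1))‖ ≤
      (2 + 3 * k) * ((if N = 0 then 1 else 0) + R * (N : ℝ) ^ (-(1 + δ))) := by
  rw [norm_mul, Complex.norm_real, Real.norm_eq_abs]
  have ha := abs_hCoeff_le hk N
  have hR0 : 0 ≤ R := (norm_nonneg _).trans hR
  rcases eq_or_ne N 0 with rfl | hN
  · rw [zetaPow_zero, zetaPow_succ]
    simp only [zero_add, Nat.cast_one, one_cpow, zero_sub, norm_neg, norm_one, mul_one, if_true,
      Nat.cast_zero, Real.zero_rpow (show -(1 + δ) ≠ 0 by linarith), mul_zero, add_zero] at ha ⊢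
    simpa using ha
  · have hN1 : (1 : ℝ) ≤ N := by exact_mod_cast Nat.one_le_iff_ne_zero.2 hN
    have hNpos : (0 : ℝ) < N := by linarith
    have h1 := norm_zetaPow_sub_le (hδ.trans_le hs) hN
    have h2 : (N : ℝ) ^ (-s.re) ≤ (N : ℝ) ^ (-δ) :=
      Real.rpow_le_rpow_of_exponent_le hN1 (by linarith)
    have h3 : |hCoeff k N| ≤ (2 + 3 * k) * (N : ℝ)⁻¹ := by
      refine ha.trans ?_
      rw [div_eq_mul_inv]
      gcongr
      linarith
    have h4 : ‖zetaPow s N - zetaPow s (N + 1)‖ ≤ R * (N : ℝ) ^ (-δ) :=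
      h1.trans (mul_le_mul hR h2 (by positivity) hR0)
    rw [if_neg hN, zero_add, neg_add, Real.rpow_add hNpos, Real.rpow_neg_one]
    refine (mul_le_mul h3 h4 (norm_nonneg _) (by positivity)).trans_eq ?_
    ring

theorem summable_pairing_bound (k : ℕ) {δ : ℝ} (hδ : 0 < δ) (R : ℝ) : Summable fun N : ℕ =>
    (2 + 3 * (k : ℝ)) * ((if N = 0 then 1 else 0) + R * (N : ℝ) ^ (-(1 + δ))) :=
  ((hasSum_ite_eq 0 (1 : ℝ)).summable.add
    ((Real.summable_nat_rpow.2 (by linarith)).mul_left R)).mul_left _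

theorem summable_pairing {k : ℕ} (hk : k ≠ 0) {s : ℂ} (hs : 0 < s.re) :
    Summable fun N => (hCoeff k N : ℂ) * (zetaPow s N - zetaPow s (N + 1)) :=
  Summable.of_norm_bounded (summable_pairing_bound k hs ‖1 - s‖)
    (norm_hCoeff_mul_zetaPow_sub_le hk hs le_rfl le_rfl)

theorem differentiableOn_pairing {k : ℕ} (hk : k ≠ 0) : DifferentiableOn ℂ
    (fun s => ∑' N, (hCoeff k N : ℂ) * (zetaPow s N - zetaPow s (N + 1))) {s | 0 < s.re} := by
  intro s hs
  have hs' : 0 < s.re := hs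
  let U : Set ℂ := {w | s.re / 2 < w.re} ∩ Metric.ball 1 (‖1 - s‖ + 1)
  have hU : IsOpen U := (isOpen_lt continuous_const continuous_re).inter Metric.isOpen_ball
  have hsU : s ∈ U := ⟨by change s.re / 2 < s.re; linarith, by
    rw [mem_ball_iff_norm, norm_sub_rev]; linarith⟩
  have hb : ∀ (N : ℕ), Differentiable ℂ fun w => zetaPow w N := by
    intro N
    rcases eq_or_ne N 0 with rfl | hN
    · simp only [zetaPow_zero]; fun_prop
    · simp only [zetaPow, if_neg hN]
      exact fun w => DifferentiableAt.const_cpow (by fun_prop)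
        (Or.inl (by exact_mod_cast hN))
  have h := differentiableOn_tsum_of_summable_norm
    (F := fun N w => (hCoeff k N : ℂ) * (zetaPow w N - zetaPow w (N + 1)))
    (summable_pairing_bound k (half_pos hs') (‖1 - s‖ + 1))
    (fun N => (((hb N).sub (hb (N + 1))).const_mul _).differentiableOn) hU
    fun N w hw => norm_hCoeff_mul_zetaPow_sub_le hk (half_pos hs') (le_of_lt hw.1)
      (by have := hw.2; rw [mem_ball_iff_norm, norm_sub_rev] at this; exact this.le) N
  exact ((h s hsU).differentiableAt (hU.mem_nhds hsU)).differentiableWithinAt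

/-- Summation by parts. -/
theorem sum_range_mul_sub_succ (a b : ℕ → ℂ) (M : ℕ) :
    ∑ N ∈ Finset.range (M + 1), a N * (b N - b (N + 1)) =
      a 0 * b 0 + ∑ N ∈ Finset.range M, (a (N + 1) - a N) * b (N + 1) - a M * b (M + 1) := by
  induction M with
  | zero => simp; ring
  | succ M ih => rw [Finset.sum_range_succ, ih, Finset.sum_range_succ]; ring

/-- The coefficients of `k h_k` jump by `1/n` at each `n`, and by `-k/n` more at the multiples
of `k`. -/
theorem hCoeff_succ_sub {k : ℕ} (hk : k ≠ 0) (N : ℕ) : hCoeff k (N + 1) - hCoeff k N =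
    1 / ((N + 1 : ℕ) : ℝ) - if k ∣ N + 1 then k / ((N + 1 : ℕ) : ℝ) else 0 := by
  have hk0 : (k : ℝ) ≠ 0 := by exact_mod_cast hk
  simp only [hCoeff, harmonic_succ, Nat.succ_div]
  split_ifs with h
  · have h1 : (N + 1 : ℕ) = k * (N / k + 1) := by
      have := Nat.succ_div_of_dvd h
      rw [← this, Nat.mul_div_cancel' h]
    have h2 : (k : ℝ) / ((N + 1 : ℕ) : ℝ) = 1 / ((N / k + 1 : ℕ) : ℝ) := by
      rw [h1, Nat.cast_mul, div_mul_eq_div_div, div_self hk0]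
    rw [harmonic_succ, h2]; push_cast; ring
  · push_cast; ring_nf

/-- In the half-plane of absolute convergence, the coefficient jumps of `h_k` at the multiples of
`k` turn the pairing into `(1 - k ^ (1 - s)) ζ(s)`. -/
theorem hasSum_hCoeff_sub_mul_zetaPow {k : ℕ} (hk : k ≠ 0) {s : ℂ} (hs : 1 < s.re) :
    HasSum (fun N => ((hCoeff k (N + 1) : ℂ) - hCoeff k N) * zetaPow s (N + 1))
      ((1 - (k : ℂ) ^ (1 - s)) * riemannZeta s) := by
  have hk0 : (k : ℂ) ≠ 0 := by exact_mod_cast hk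
  have hs0 : s ≠ 0 := fun h => by simp [h] at hs; linarith
  have z1 : HasSum (fun n : ℕ => 1 / (n : ℂ) ^ s) (riemannZeta s) := by
    rw [zeta_eq_tsum_one_div_nat_cpow hs]
    exact (Complex.summable_one_div_nat_cpow.2 hs).hasSum
  have z2 : HasSum (fun n : ℕ => if k ∣ n then (k : ℂ) * (1 / (n : ℂ) ^ s) else 0)
      ((k : ℂ) ^ (1 - s) * riemannZeta s) := by
    have hinj : Function.Injective fun m : ℕ => k * m := fun a b h =>
      Nat.eq_of_mul_eq_mul_left (Nat.pos_of_ne_zero hk) h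
    rw [← hinj.hasSum_iff]
    · refine (z1.mul_left ((k : ℂ) ^ (1 - s))).congr_fun ?_
      intro m
      simp only [Function.comp_apply, dvd_mul_right, if_true]
      rw [Nat.cast_mul, natCast_mul_natCast_cpow, cpow_sub _ _ hk0, cpow_one]
      field_simp
    · rintro n hn
      rw [if_neg]
      rintro ⟨m, rfl⟩
      exact hn ⟨m, rfl⟩
  have z3 := (hasSum_nat_add_iff' 1).2 (z1.sub z2)
  simp only [Finset.sum_range_one, Nat.cast_zero, zero_cpow hs0, div_zero, mul_zero, ite_self,
    sub_zero] at z3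
  rw [sub_mul, one_mul]
  refine z3.congr_fun fun N => ?_
  have hN0 : ((N + 1 : ℕ) : ℂ) ≠ 0 := by exact_mod_cast N.succ_ne_zero
  rw [← ofReal_sub, hCoeff_succ_sub hk, zetaPow_succ, cpow_sub _ _ hN0, cpow_one]
  split_ifs
  · push_cast
    have : (N : ℂ) + 1 ≠ 0 := by exact_mod_cast hN0
    field_simp
  · push_cast
    have : (N : ℂ) + 1 ≠ 0 := by exact_mod_cast hN0
    field_simp
    ring_nf

theorem tsum_pairing_of_one_lt_re {k : ℕ} (hk : k ≠ 0) {s : ℂ} (hs : 1 < s.re) :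
    ∑' N, (hCoeff k N : ℂ) * (zetaPow s N - zetaPow s (N + 1)) =
      (1 - (k : ℂ) ^ (1 - s)) * riemannZeta s := by
  have h1 := (summable_pairing hk (s := s) (by linarith)).hasSum.tendsto_sum_nat
  have h2 := (hasSum_hCoeff_sub_mul_zetaPow hk hs).tendsto_sum_nat
  have h3 : Tendsto (fun M => (hCoeff k M : ℂ) * zetaPow s (M + 1)) atTop (𝓝 0) := by
    have hb : Tendsto (fun M : ℕ => (2 + 3 * (k : ℝ)) / ((M : ℝ) + 1)) atTop (𝓝 0) :=
      tendsto_const_nhds.div_atTop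
        (tendsto_atTop_add_const_right _ _ tendsto_natCast_atTop_atTop)
    refine squeeze_zero_norm (fun M => ?_) hb
    rw [norm_mul, Complex.norm_real, Real.norm_eq_abs, zetaPow_succ,
      Complex.norm_natCast_cpow_of_pos M.succ_pos, sub_re, one_re]
    refine (mul_le_of_le_one_right (abs_nonneg _) ?_).trans (abs_hCoeff_le hk M)
    exact Real.rpow_le_one_of_one_le_of_nonpos (by simp) (by linarith)
  have h4 := h2.sub h3
  rw [sub_zero] at h4
  refine tendsto_nhds_unique ((tendsto_add_atTop_iff_nat 1).2 h1) (h4.congr fun M => ?_)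
  rw [sum_range_mul_sub_succ (fun N => (hCoeff k N : ℂ)) (zetaPow s), zetaPow_zero, mul_zero,
    zero_add]

/-- The pairing continues `(1 - k ^ (1 - s)) ζ(s)` to the half-plane `0 < re s`. -/
theorem tsum_pairing_eq {k : ℕ} (hk : k ≠ 0) {s : ℂ} (hs : 0 < s.re) (hs1 : s ≠ 1) :
    ∑' N, (hCoeff k N : ℂ) * (zetaPow s N - zetaPow s (N + 1)) =
      (1 - (k : ℂ) ^ (1 - s)) * riemannZeta s := by
  have hk0 : (k : ℂ) ≠ 0 := by exact_mod_cast hk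
  have hopen : IsOpen {s : ℂ | 0 < s.re} := isOpen_lt continuous_const continuous_re
  have hconv : Convex ℝ {s : ℂ | 0 < s.re} := convex_halfSpace_re_gt 0
  -- multiplication by `s - 1` removes the pole at `1`
  have hL : DifferentiableOn ℂ (fun s => (s - 1) * ∑' N, (hCoeff k N : ℂ) *
      (zetaPow s N - zetaPow s (N + 1))) {s | 0 < s.re} :=
    DifferentiableOn.mul (by fun_prop) (differentiableOn_pairing hk)
  have hR : DifferentiableOn ℂ (fun s => (1 - (k : ℂ) ^ (1 - s)) * riemannZeta₁ s)
      {s | 0 < s.re} := by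
    refine Differentiable.differentiableOn (Differentiable.mul ?_ differentiable_riemannZeta₁)
    exact fun w => (differentiableAt_const _).sub
      (DifferentiableAt.const_cpow (by fun_prop) (Or.inl hk0))
  have hne : ∀ w : ℂ, w ≠ 1 → riemannZeta₁ w = (w - 1) * riemannZeta w := by
    intro w hw
    rw [riemannZeta_eq_inv_sub_mul hw, mul_inv_cancel_left₀ (sub_ne_zero.2 hw)]
  have key := (hL.analyticOnNhd hopen).eqOn_of_preconnected_of_eventuallyEq
    (hR.analyticOnNhd hopen) hconv.isPreconnected (z₀ := 2) (by simp) (by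
      -- the two sides agree near `2`, in the half-plane of absolute convergence
      filter_upwards [(isOpen_lt continuous_const continuous_re).mem_nhds
        (show (2 : ℂ) ∈ {w : ℂ | 1 < w.re} by simp)] with w hw
      have hw' : 1 < w.re := hw
      rw [tsum_pairing_of_one_lt_re hk hw', hne w fun h => by simp [h] at hw']
      ring) hs
  simp only [hne s hs1] at key
  refine mul_left_cancel₀ (sub_ne_zero.2 hs1) (key.trans ?_)
  ring

/-! ### The annihilating functional at a zero of zeta -/

/-- The weight `t ^ (s - 2) (1 - e ^ (-t))`. -/
noncomputable def mellinWeight (s : ℂ) (t : ℝ) : ℂ :=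
  (t : ℂ) ^ (s - 2) * ((1 - Real.exp (-t) : ℝ) : ℂ)

theorem one_sub_exp_neg_pos {t : ℝ} (ht : 0 < t) : 0 < 1 - Real.exp (-t) :=
  sub_pos.2 (Real.exp_lt_one_iff.2 (by linarith))

theorem norm_mellinWeight (s : ℂ) {t : ℝ} (ht : 0 < t) :
    ‖mellinWeight s t‖ = t ^ (s.re - 2) * (1 - Real.exp (-t)) := by
  rw [mellinWeight, norm_mul, Complex.norm_real, Real.norm_of_nonneg (one_sub_exp_neg_pos ht).le,
    Complex.norm_cpow_eq_rpow_re_of_pos ht]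
  simp

theorem continuousOn_ofReal_cpow (c : ℂ) : ContinuousOn (fun t : ℝ => (t : ℂ) ^ c) (Ioi 0) :=
  fun _ ht => ((continuousAt_ofReal_cpow_const _ _ (Or.inr (ne_of_gt ht)))).continuousWithinAt

theorem continuousOn_mellinWeight (s : ℂ) : ContinuousOn (mellinWeight s) (Ioi 0) :=
  (continuousOn_ofReal_cpow _).mul (by fun_prop)

/-- The integrand is at most `t ^ (τ - 1 - α)` near `0` and at most `t ^ (τ - 2)` near `∞`. -/
theorem integrableOn_rpow_mul_one_sub_exp {τ α : ℝ} (hατ : α < τ)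
    (hτ : τ < 1) :
    IntegrableOn (fun t : ℝ => t ^ (τ - 2) * (1 - Real.exp (-t)) ^ (1 - α)) (Ioi 0) := by
  have hcont : ContinuousOn (fun t : ℝ => t ^ (τ - 2) * (1 - Real.exp (-t)) ^ (1 - α)) (Ioi 0) :=
    (continuousOn_id.rpow_const fun t ht => Or.inl (ne_of_gt ht)).mul
      (ContinuousOn.rpow_const (by fun_prop) fun t _ => Or.inr (by linarith))
  have hnn : ∀ t : ℝ, 0 < t → 0 ≤ t ^ (τ - 2) * (1 - Real.exp (-t)) ^ (1 - α) := fun t ht => by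
    have := one_sub_exp_neg_pos ht
    positivity
  rw [← Ioc_union_Ioi_eq_Ioi (zero_le_one' ℝ)]
  refine IntegrableOn.union ?_ ?_
  · have hint : IntegrableOn (fun t : ℝ => t ^ (τ - 1 - α)) (Ioc 0 1) := by
      rw [← intervalIntegrable_iff_integrableOn_Ioc_of_le zero_le_one]
      exact intervalIntegral.intervalIntegrable_rpow' (by linarith)
    refine Integrable.mono' hint
      ((hcont.mono Ioc_subset_Ioi_self).aestronglyMeasurable measurableSet_Ioc) ?_
    filter_upwards [ae_restrict_mem measurableSet_Ioc] with t ht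
    rw [Real.norm_of_nonneg (hnn t ht.1)]
    have h1 : 1 - Real.exp (-t) ≤ t := by linarith [Real.one_sub_le_exp_neg t]
    have h2 : (1 - Real.exp (-t)) ^ (1 - α) ≤ t ^ (1 - α) :=
      Real.rpow_le_rpow (one_sub_exp_neg_pos ht.1).le h1 (by linarith)
    calc t ^ (τ - 2) * (1 - Real.exp (-t)) ^ (1 - α) ≤ t ^ (τ - 2) * t ^ (1 - α) :=
          mul_le_mul_of_nonneg_left h2 (Real.rpow_nonneg ht.1.le _)
      _ = t ^ (τ - 1 - α) := by rw [← Real.rpow_add ht.1]; ring_nf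
  · refine Integrable.mono' (integrableOn_Ioi_rpow_of_lt (a := τ - 2) (by linarith) zero_lt_one)
      ((hcont.mono (Ioi_subset_Ioi zero_le_one)).aestronglyMeasurable measurableSet_Ioi) ?_
    filter_upwards [ae_restrict_mem measurableSet_Ioi] with t ht
    have ht0 : 0 < t := zero_lt_one.trans ht
    rw [Real.norm_of_nonneg (hnn t ht0)]
    refine mul_le_of_le_one_right (by positivity)
      (Real.rpow_le_one (one_sub_exp_neg_pos ht0).le ?_ (by linarith))
    linarith [Real.exp_pos (-t)]

theorem exp_neg_mem_unitBall {t : ℝ} (ht : 0 < t) :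
    ((Real.exp (-t) : ℝ) : ℂ) ∈ Metric.ball (0 : ℂ) 1 := by
  rw [mem_ball_zero_iff, Complex.norm_real, Real.norm_of_nonneg (Real.exp_pos _).le]
  exact Real.exp_lt_one_iff.2 (by linarith)

theorem HardySpace.norm_apply_exp_neg_le (f : HardySpace p hp) {t : ℝ} (ht : 0 < t) :
    ‖extZero f.1 (Real.exp (-t) : ℝ)‖ ≤
      2 ^ (1 / p) * ‖f‖ * (1 - Real.exp (-t)) ^ (-(1 / p)) := by
  have hp0 : 0 < p := by linarith
  have hx := one_sub_exp_neg_pos ht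
  have h := f.norm_apply_rpow_mul_le (mem_ball_zero_iff.1 (exp_neg_mem_unitBall ht))
  rw [Complex.norm_real, Real.norm_of_nonneg (Real.exp_pos _).le, ← le_div_iff₀ hx] at h
  have h2 := Real.rpow_le_rpow (by positivity) h (z := 1 / p) (by positivity)
  rw [one_div, Real.rpow_rpow_inv (norm_nonneg _) hp0.ne',
    Real.div_rpow (by positivity) hx.le, Real.mul_rpow (by norm_num) (by positivity),
    Real.rpow_rpow_inv (norm_nonneg _) hp0.ne'] at h2
  rwa [Real.rpow_neg hx.le, one_div, ← div_eq_mul_inv]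

theorem HardySpace.norm_mellinWeight_mul_le (f : HardySpace p hp) (s : ℂ) {t : ℝ} (ht : 0 < t) :
    ‖mellinWeight s t * extZero f.1 (Real.exp (-t) : ℝ)‖ ≤
      2 ^ (1 / p) * ‖f‖ * (t ^ (s.re - 2) * (1 - Real.exp (-t)) ^ (1 - 1 / p)) := by
  have hx := one_sub_exp_neg_pos ht
  rw [norm_mul, norm_mellinWeight s ht, sub_eq_add_neg 1 (1 / p), Real.rpow_add hx, Real.rpow_one]
  refine (mul_le_mul_of_nonneg_left (f.norm_apply_exp_neg_le ht) (by positivity)).trans_eq ?_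
  ring

theorem HardySpace.integrableOn_mellinWeight_mul (f : HardySpace p hp) {s : ℂ}
    (hs : 1 / p < s.re) (hs1 : s.re < 1) :
    IntegrableOn (fun t : ℝ => mellinWeight s t * extZero f.1 (Real.exp (-t) : ℝ)) (Ioi 0) := by
  refine Integrable.mono' ((integrableOn_rpow_mul_one_sub_exp (τ := s.re) (α := 1 / p)
    hs hs1).const_mul (2 ^ (1 / p) * ‖f‖))
    (ContinuousOn.aestronglyMeasurable ((continuousOn_mellinWeight s).mul
      (f.2.1.continuousOn.comp (by fun_prop) fun t ht => exp_neg_mem_unitBall ht))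
      measurableSet_Ioi) ?_
  filter_upwards [ae_restrict_mem measurableSet_Ioi] with t ht
  exact f.norm_mellinWeight_mul_le s ht

/-- The functional `f ↦ ∫_0^∞ t ^ (s - 2) (1 - e ^ (-t)) f(e ^ (-t)) dt` on `H^p`. It converges for
`1 / p < re s < 1`, by the growth bound `|f(z)| ≤ C ‖f‖ (1 - |z|) ^ (-1/p)`. -/
noncomputable def mellinFunctional (p : ℝ) (hp : 1 ≤ p) (s : ℂ) (hs : 1 / p < s.re)
    (hs1 : s.re < 1) : HardySpace p hp →L[ℂ] ℂ :=
  LinearMap.mkContinuous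
    { toFun := fun f => ∫ t in Ioi (0 : ℝ), mellinWeight s t * extZero f.1 (Real.exp (-t) : ℝ)
      map_add' := fun f g => by
        rw [← integral_add (f.integrableOn_mellinWeight_mul hs hs1)
          (g.integrableOn_mellinWeight_mul hs hs1)]
        refine integral_congr_ae (Eventually.of_forall fun t => ?_)
        change mellinWeight s t * extZero (f.1 + g.1) _ = _
        simp only [extZero_add, Pi.add_apply, mul_add]
      map_smul' := fun c f => by
        rw [RingHom.id_apply, smul_eq_mul, ← integral_const_mul]
        refine integral_congr_ae (Eventually.of_forall fun t => ?_)
        change mellinWeight s t * extZero (c • f.1) _ = _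
        simp only [extZero_smul, Pi.smul_apply, smul_eq_mul, mul_left_comm] }
    (2 ^ (1 / p) * ∫ t in Ioi (0 : ℝ), t ^ (s.re - 2) * (1 - Real.exp (-t)) ^ (1 - 1 / p))
    fun f => by
      refine (norm_integral_le_integral_norm _).trans ?_
      have hB := integrableOn_rpow_mul_one_sub_exp (τ := s.re) (α := 1 / p) hs hs1
      refine (setIntegral_mono_on (f.integrableOn_mellinWeight_mul hs hs1).norm
        (hB.const_mul (2 ^ (1 / p) * ‖f‖)) measurableSet_Ioi
        fun t ht => f.norm_mellinWeight_mul_le s ht).trans_eq ?_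
      rw [integral_const_mul]
      ring

theorem mellinFunctional_apply {s : ℂ} (hs : 1 / p < s.re) (hs1 : s.re < 1)
    (f : HardySpace p hp) : mellinFunctional p hp s hs hs1 f =
      ∫ t in Ioi (0 : ℝ), mellinWeight s t * extZero f.1 (Real.exp (-t) : ℝ) := rfl

theorem integrableOn_cpow_mul_exp {s : ℂ} (hs : 0 < s.re) {N : ℕ} (hN : N ≠ 0) :
    IntegrableOn (fun t : ℝ => (t : ℂ) ^ (s - 1) * Complex.exp (-((N : ℝ) * t))) (Ioi 0) := by
  have hN0 : (0 : ℝ) < N := by exact_mod_cast Nat.pos_of_ne_zero hN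
  have h := integrableOn_rpow_mul_exp_neg_mul_rpow (s := s.re - 1) (p := 1) (b := N)
    (by linarith) zero_lt_one hN0
  refine Integrable.mono' h (ContinuousOn.aestronglyMeasurable
    ((continuousOn_ofReal_cpow _).mul (by fun_prop)) measurableSet_Ioi) ?_
  filter_upwards [ae_restrict_mem measurableSet_Ioi] with t ht
  rw [norm_mul, Complex.norm_cpow_eq_rpow_re_of_pos ht, Complex.norm_exp]
  simp

theorem norm_mellinWeight_mul_exp_pow_le (s : ℂ) (N : ℕ) {t : ℝ} (ht : 0 < t) :
    ‖mellinWeight s t * ((Real.exp (-t) : ℝ) : ℂ) ^ N‖ ≤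
      t ^ (s.re - 2) * (1 - Real.exp (-t)) ^ (1 - (0 : ℝ)) := by
  have hx := one_sub_exp_neg_pos ht
  rw [norm_mul, norm_mellinWeight s ht, norm_pow, Complex.norm_real,
    Real.norm_of_nonneg (Real.exp_pos _).le, sub_zero, Real.rpow_one]
  exact mul_le_of_le_one_right (by positivity)
    (pow_le_one₀ (Real.exp_pos _).le (Real.exp_le_one_iff.2 (by linarith)))

theorem integrableOn_mellinWeight_mul_exp_pow {s : ℂ} (hs : 0 < s.re) (hs1 : s.re < 1) (N : ℕ) :
    IntegrableOn (fun t : ℝ => mellinWeight s t * ((Real.exp (-t) : ℝ) : ℂ) ^ N) (Ioi 0) := by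
  refine Integrable.mono' (integrableOn_rpow_mul_one_sub_exp (τ := s.re) (α := 0) hs hs1)
    (ContinuousOn.aestronglyMeasurable
      ((continuousOn_mellinWeight s).mul (by fun_prop)) measurableSet_Ioi) ?_
  filter_upwards [ae_restrict_mem measurableSet_Ioi] with t ht
  exact norm_mellinWeight_mul_exp_pow_le s N ht

/-- `N` times the Mellin transform of `e ^ (-Nt)`; both sides vanish for `N = 0`. -/
theorem natCast_mul_integral_cpow_mul_exp {s : ℂ} (hs : 0 < s.re) (N : ℕ) :
    (N : ℂ) * ∫ t in Ioi (0 : ℝ), (t : ℂ) ^ (s - 1) * Complex.exp (-((N : ℝ) * t)) =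
      Gamma s * zetaPow s N := by
  rcases eq_or_ne N 0 with rfl | hN
  · simp [zetaPow_zero]
  have hN0 : (0 : ℝ) < N := by exact_mod_cast Nat.pos_of_ne_zero hN
  have hNC : (N : ℂ) ≠ 0 := by exact_mod_cast hN
  rw [Complex.integral_cpow_mul_exp_neg_mul_Ioi hs hN0, zetaPow, if_neg hN, ofReal_natCast,
    one_div, inv_cpow _ _ (by rw [natCast_arg]; exact Real.pi_pos.ne), cpow_sub _ _ hNC, cpow_one]
  ring

/-- The moments of the weight, by integration by parts from the Gamma integral. -/
theorem integral_mellinWeight_mul_exp_pow {s : ℂ} (hs : 0 < s.re) (hs1 : s.re < 1) (N : ℕ) :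
    ∫ t in Ioi (0 : ℝ), mellinWeight s t * ((Real.exp (-t) : ℝ) : ℂ) ^ N =
      Gamma s / (s - 1) * (zetaPow s N - zetaPow s (N + 1)) := by
  have hsne : s - 1 ≠ 0 := fun h => by
    rw [sub_eq_zero] at h; simp [h] at hs1
  set u : ℝ → ℂ := fun t => (t : ℂ) ^ (s - 1) with hu
  set u' : ℝ → ℂ := fun t => (s - 1) * (t : ℂ) ^ (s - 2) with hu'
  set E : ℕ → ℝ → ℂ := fun n t => Complex.exp (-((n : ℝ) * t)) with hE
  set v : ℝ → ℂ := fun t => E N t - E (N + 1) t with hv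
  set v' : ℝ → ℂ := fun t => ((N + 1 : ℕ) : ℂ) * E (N + 1) t - (N : ℂ) * E N t with hv'
  have dE : ∀ (n : ℕ) (t : ℝ), HasDerivAt (E n) (-((n : ℂ) * E n t)) t := by
    intro n t
    have h1 : HasDerivAt (fun z : ℂ => Complex.exp (-(((n : ℝ) : ℂ) * z)))
        (Complex.exp (-(((n : ℝ) : ℂ) * (t : ℂ))) * -(((n : ℝ) : ℂ) * 1)) (t : ℂ) :=
      ((((hasDerivAt_id (t : ℂ)).const_mul ((n : ℝ) : ℂ)).neg).cexp)
    refine h1.comp_ofReal.congr_deriv ?_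
    simp only [hE, ofReal_natCast]
    ring
  have du : ∀ t ∈ Ioi (0 : ℝ), HasDerivAt u (u' t) t := by
    intro t ht
    have := ((hasDerivAt_id (t : ℂ)).cpow_const (c := s - 1)
      (ofReal_mem_slitPlane.2 ht)).comp_ofReal
    refine this.congr_deriv ?_
    simp only [hu', id, mul_one]
    ring_nf
  have dv : ∀ t ∈ Ioi (0 : ℝ), HasDerivAt v (v' t) t := fun t _ =>
    ((dE N t).sub (dE (N + 1) t)).congr_deriv (by simp only [hv']; ring)
  have hwv : ∀ t : ℝ, u' t * v t =
      (s - 1) * (mellinWeight s t * ((Real.exp (-t) : ℝ) : ℂ) ^ N) := by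
    intro t
    have hEt : ∀ n : ℕ, E n t = ((Real.exp (-t) : ℝ) : ℂ) ^ n := by
      intro n
      rw [ofReal_exp, ← Complex.exp_nat_mul]
      simp only [hE]; push_cast; ring_nf
    simp only [hu', hv, hEt, mellinWeight, pow_succ]
    push_cast
    ring
  have iE : ∀ n : ℕ, IntegrableOn (fun t => (n : ℂ) * (u t * E n t)) (Ioi 0) := by
    intro n
    rcases eq_or_ne n 0 with rfl | hn
    · simp
    · exact (integrableOn_cpow_mul_exp hs hn).const_mul _
  have huv' : u * v' = fun t => ((N + 1 : ℕ) : ℂ) * (u t * E (N + 1) t) -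
      (N : ℂ) * (u t * E N t) := by
    ext t; simp only [Pi.mul_apply, hv']; ring
  have i1 : IntegrableOn (u * v') (Ioi 0) := by
    rw [huv']; exact (iE (N + 1)).sub (iE N)
  have i2 : IntegrableOn (u' * v) (Ioi 0) := by
    have : u' * v = fun t => (s - 1) * (mellinWeight s t * ((Real.exp (-t) : ℝ) : ℂ) ^ N) :=
      funext hwv
    rw [this]
    exact (integrableOn_mellinWeight_mul_exp_pow hs hs1 N).const_mul _
  have hvb : ∀ t : ℝ, 0 < t → ‖(u * v) t‖ ≤ t ^ (s.re - 1) * (1 - Real.exp (-t)) := by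
    intro t ht
    have hx := one_sub_exp_neg_pos ht
    have h1 : v t = ((Real.exp (-t) ^ N * (1 - Real.exp (-t)) : ℝ) : ℂ) := by
      simp only [hv, hE]
      push_cast
      rw [← Complex.exp_nat_mul, mul_sub, ← Complex.exp_add]
      ring_nf
    rw [Pi.mul_apply, norm_mul, h1, Complex.norm_real, Real.norm_of_nonneg (by positivity)]
    simp only [hu, Complex.norm_cpow_eq_rpow_re_of_pos ht, sub_re, one_re]
    refine mul_le_mul_of_nonneg_left (mul_le_of_le_one_left hx.le ?_) (by positivity)
    exact pow_le_one₀ (Real.exp_pos _).le (Real.exp_le_one_iff.2 (by linarith))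
  -- the boundary terms vanish at `0` because `0 < re s`, and at `∞`, also for `N = 0`, because
  -- `re s < 1`
  have l0 : Tendsto (u * v) (𝓝[>] 0) (𝓝 0) := by
    have h0 : Tendsto (fun t : ℝ => t ^ s.re) (𝓝[>] 0) (𝓝 0) := by
      have := (Real.continuousAt_rpow_const 0 s.re (Or.inr hs.le)).tendsto
      rw [Real.zero_rpow hs.ne'] at this
      exact this.mono_left nhdsWithin_le_nhds
    refine squeeze_zero_norm' ?_ h0
    filter_upwards [self_mem_nhdsWithin] with t ht
    have ht' : 0 < t := ht
    refine (hvb t ht').trans ?_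
    have h1 : 1 - Real.exp (-t) ≤ t := by linarith [Real.one_sub_le_exp_neg t]
    refine (mul_le_mul_of_nonneg_left h1 (by positivity)).trans_eq ?_
    rw [Real.rpow_sub_one ht'.ne', div_mul_cancel₀ _ ht'.ne']
  have l1 : Tendsto (u * v) atTop (𝓝 0) := by
    have h0 : Tendsto (fun t : ℝ => t ^ (s.re - 1)) atTop (𝓝 0) := by
      have := tendsto_rpow_neg_atTop (y := 1 - s.re) (by linarith)
      simpa using this
    refine squeeze_zero_norm' ?_ h0
    filter_upwards [eventually_gt_atTop 0] with t ht
    refine (hvb t ht).trans (mul_le_of_le_one_right (by positivity) ?_)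
    linarith [Real.exp_pos (-t)]
  have key := integral_Ioi_mul_deriv_eq_deriv_mul du dv i1 i2 l0 l1
  have k1 : ∫ t in Ioi (0 : ℝ), u t * v' t =
      Gamma s * zetaPow s (N + 1) - Gamma s * zetaPow s N := by
    have : ∀ t, u t * v' t = ((N + 1 : ℕ) : ℂ) * (u t * E (N + 1) t) - (N : ℂ) * (u t * E N t) :=
      fun t => congrFun huv' t
    simp only [this]
    rw [integral_sub (iE (N + 1)) (iE N), integral_const_mul, integral_const_mul,
      natCast_mul_integral_cpow_mul_exp hs, natCast_mul_integral_cpow_mul_exp hs]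
  simp only [hwv] at key
  rw [k1, integral_const_mul, sub_zero, zero_sub] at key
  rw [div_mul_eq_mul_div, eq_div_iff hsne]
  linear_combination key

theorem integral_norm_mellinWeight_mul_exp_pow_le {s : ℂ} (hs : 0 < s.re) (hs1 : s.re < 1)
    {N : ℕ} (hN : N ≠ 0) :
    ∫ t in Ioi (0 : ℝ), ‖mellinWeight s t * ((Real.exp (-t) : ℝ) : ℂ) ^ N‖ ≤
      Real.Gamma s.re * (N : ℝ) ^ (-s.re) := by
  have hN0 : (0 : ℝ) < N := by exact_mod_cast Nat.pos_of_ne_zero hN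
  have hI : IntegrableOn (fun t : ℝ => t ^ (s.re - 1) * Real.exp (-(N * t))) (Ioi 0) := by
    have h := integrableOn_rpow_mul_exp_neg_mul_rpow (s := s.re - 1) (p := 1) (b := N)
      (by linarith) zero_lt_one hN0
    simpa using h
  refine (setIntegral_mono_on (integrableOn_mellinWeight_mul_exp_pow hs hs1 N).norm hI
    measurableSet_Ioi fun t ht => ?_).trans_eq ?_
  · have ht' : 0 < t := ht
    rw [norm_mul, norm_mellinWeight s ht', norm_pow, Complex.norm_real,
      Real.norm_of_nonneg (Real.exp_pos _).le, ← Real.exp_nat_mul, mul_neg]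
    refine mul_le_mul_of_nonneg_right ?_ (Real.exp_pos _).le
    have h1 : 1 - Real.exp (-t) ≤ t := by linarith [Real.one_sub_le_exp_neg t]
    refine (mul_le_mul_of_nonneg_left h1 (by positivity)).trans_eq ?_
    rw [show s.re - 2 = s.re - 1 - 1 by ring, Real.rpow_sub_one ht'.ne' (s.re - 1),
      div_mul_cancel₀ _ ht'.ne']
  · rw [Real.integral_rpow_mul_exp_neg_mul_Ioi hs hN0, one_div, Real.inv_rpow hN0.le,
      Real.rpow_neg hN0.le, mul_comm]

/-- Integrating the Taylor series of `h_k` term by term gives the pairing that represents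
`(1 - k ^ (1 - s)) ζ(s)`. -/
theorem mellinFunctional_hElem (hp2 : p ≤ 2) {k : ℕ} (hk : k ≠ 0) {s : ℂ} (hs : 1 / p < s.re)
    (hs1 : s.re < 1) : mellinFunctional p hp s hs hs1 (hElem p hp hp2 k) =
      1 / (k : ℂ) * (Gamma s / (s - 1)) * ((1 - (k : ℂ) ^ (1 - s)) * riemannZeta s) := by
  have hp0 : 0 < p := by linarith
  have hs0 : 0 < s.re := (by positivity : (0 : ℝ) < 1 / p).trans hs
  have hsne : s ≠ 1 := fun h => by simp [h] at hs1
  set Φ : ℕ → ℝ → ℂ := fun N t => (1 / (k : ℂ) * (hCoeff k N : ℂ)) *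
    (mellinWeight s t * ((Real.exp (-t) : ℝ) : ℂ) ^ N) with hΦ
  have hint : ∀ N, IntegrableOn (Φ N) (Ioi 0) := fun N =>
    (integrableOn_mellinWeight_mul_exp_pow hs0 hs1 N).const_mul _
  have hk1 : ‖1 / (k : ℂ)‖ ≤ 1 := by
    rw [norm_div, norm_one, Complex.norm_natCast]
    exact div_le_one_of_le₀ (by exact_mod_cast Nat.one_le_iff_ne_zero.2 hk) (by positivity)
  have hsum : Summable fun N => ∫ t in Ioi (0 : ℝ), ‖Φ N t‖ := by
    -- the `N`-th coefficient is `O(1/N)` and the `N`-th integral is `O(N ^ (-re s))`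
    have hmaj : Summable fun N : ℕ => (2 + 3 * (k : ℝ)) * Real.Gamma s.re *
        (N : ℝ) ^ (-(1 + s.re)) := (Real.summable_nat_rpow.2 (by linarith)).mul_left _
    refine (summable_nat_add_iff 1).1 (Summable.of_nonneg_of_le
      (fun N => integral_nonneg fun t => norm_nonneg _) (fun N => ?_)
      ((summable_nat_add_iff 1).2 hmaj))
    have hN : N + 1 ≠ 0 := N.succ_ne_zero
    have hN0 : (0 : ℝ) < (N + 1 : ℕ) := by positivity
    have hG := Real.Gamma_pos_of_pos hs0
    have h1 := integral_norm_mellinWeight_mul_exp_pow_le hs0 hs1 hN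
    have h2 : |hCoeff k (N + 1)| ≤ (2 + 3 * k) * ((N + 1 : ℕ) : ℝ)⁻¹ := by
      refine (abs_hCoeff_le hk (N + 1)).trans ?_
      rw [div_eq_mul_inv]
      gcongr
      linarith
    have h3 : ‖1 / (k : ℂ) * (hCoeff k (N + 1) : ℂ)‖ ≤ (2 + 3 * k) * ((N + 1 : ℕ) : ℝ)⁻¹ := by
      rw [norm_mul, Complex.norm_real, Real.norm_eq_abs]
      exact (mul_le_of_le_one_left (abs_nonneg _) hk1).trans h2
    simp only [hΦ, norm_mul (1 / (k : ℂ) * (hCoeff k (N + 1) : ℂ))]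
    rw [integral_const_mul]
    refine (mul_le_mul h3 h1 (integral_nonneg fun t => norm_nonneg _) (by positivity)).trans_eq ?_
    rw [neg_add, Real.rpow_add hN0, Real.rpow_neg_one]
    ring
  have h := hasSum_integral_of_summable_integral_norm hint hsum
  have hval : ∫ t in Ioi (0 : ℝ), ∑' N, Φ N t =
      mellinFunctional p hp s hs hs1 (hElem p hp hp2 k) := by
    rw [mellinFunctional_apply]
    refine setIntegral_congr_fun measurableSet_Ioi fun t ht => ?_
    have hz : ‖((Real.exp (-t) : ℝ) : ℂ)‖ < 1 := mem_ball_zero_iff.1 (exp_neg_mem_unitBall ht)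
    have h1 := (hasSum_hCoeff hk hz).mul_left (mellinWeight s t * (1 / (k : ℂ)))
    change ∑' N, Φ N t = mellinWeight s t * extZero (hFun k) _
    rw [extZero_of_norm_lt _ hz, hFun, UnitDisc.coe_mk, mul_assoc (1 / (k : ℂ)), ← mul_assoc,
      ← h1.tsum_eq]
    refine tsum_congr fun N => ?_
    simp only [hΦ]
    ring
  rw [← hval, ← h.tsum_eq, ← tsum_pairing_eq hk hs0 hsne, ← tsum_mul_left]
  refine tsum_congr fun N => ?_
  simp only [hΦ]
  rw [integral_const_mul, integral_mellinWeight_mul_exp_pow hs0 hs1]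
  ring

theorem mellinFunctional_one {s : ℂ} (hs : 1 / p < s.re) (hs1 : s.re < 1) :
    mellinFunctional p hp s hs hs1 1 = -(Gamma s / (s - 1)) := by
  have hp0 : 0 < p := by linarith
  have hs0 : 0 < s.re := (by positivity : (0 : ℝ) < 1 / p).trans hs
  have h := integral_mellinWeight_mul_exp_pow hs0 hs1 0
  rw [zetaPow_zero, zetaPow_succ, zero_add, Nat.cast_one, one_cpow, zero_sub, mul_neg_one] at h
  rw [← h, mellinFunctional_apply]
  refine setIntegral_congr_fun measurableSet_Ioi fun t ht => ?_
  have hz : ‖((Real.exp (-t) : ℝ) : ℂ)‖ < 1 := mem_ball_zero_iff.1 (exp_neg_mem_unitBall ht)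
  change mellinWeight s t * extZero (fun _ => 1) _ = mellinWeight s t * _
  rw [extZero_of_norm_lt _ hz, pow_zero]

theorem riemannZeta_ne_zero_of_one_mem_closure (hp2 : p ≤ 2)
    (h : (1 : HardySpace p hp) ∈ closure (hSpan p hp hp2 : Set (HardySpace p hp))) {s : ℂ}
    (hs : 1 / p < s.re) : riemannZeta s ≠ 0 := by
  rcases le_or_gt 1 s.re with hs1 | hs1
  · exact riemannZeta_ne_zero_of_one_le_re hs1
  intro hζ
  have hp0 : 0 < p := by linarith
  have hs0 : 0 < s.re := (by positivity : (0 : ℝ) < 1 / p).trans hs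
  have hsne : s - 1 ≠ 0 := fun h => by rw [sub_eq_zero] at h; simp [h] at hs1
  set Λ := mellinFunctional p hp s hs hs1 with hΛ
  have hspan : hSpan p hp hp2 ≤ LinearMap.ker (Λ : HardySpace p hp →ₗ[ℂ] ℂ) := by
    refine Submodule.span_le.2 ?_
    rintro _ ⟨k, hk, rfl⟩
    change Λ (hElem p hp hp2 k) = 0
    rw [hΛ, mellinFunctional_hElem hp2 (by omega), hζ, mul_zero, mul_zero]
  have h1 : Λ 1 = 0 :=
    closure_minimal (t := {f | Λ f = 0}) (fun f hf => hspan hf)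
      (isClosed_eq Λ.continuous continuous_const) h
  rw [hΛ, mellinFunctional_one, neg_eq_zero] at h1
  exact div_ne_zero (Gamma_ne_zero_of_re_pos hs0) hsne h1

end HardyDisc

theorem mainTheorem1 :
    (∀ (p : ℝ) (hp1 : 1 < p) (hp2 : p ≤ 2),
      ((1 : HardyDisc.HardySpace p hp1.le) ∈
          closure (HardyDisc.hSpan p hp1.le hp2 : Set (HardyDisc.HardySpace p hp1.le)) →
        ∀ s : ℂ, 1 / p < s.re → riemannZeta s ≠ 0) ∧
      ((1 : HardyDisc.HardySpace p hp1.le) ∈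
          closure (HardyDisc.hSpan p hp1.le hp2 : Set (HardyDisc.HardySpace p hp1.le)) ↔
        Dense (HardyDisc.hSpan p hp1.le hp2 : Set (HardyDisc.HardySpace p hp1.le)))) ∧
    ((1 : HardyDisc.HardySpace 1 le_rfl) ∈
        closure (HardyDisc.hSpan 1 le_rfl one_le_two : Set (HardyDisc.HardySpace 1 le_rfl)) →
      ∀ s : ℂ, 1 ≤ s.re → riemannZeta s ≠ 0) :=
  ⟨fun _ hp1 hp2 => ⟨fun h _ hs => HardyDisc.riemannZeta_ne_zero_of_one_mem_closure hp2 h hs,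
    fun h => HardyDisc.dense_hSpan_of_one_mem_closure hp1 hp2 h, fun h => h 1⟩,
    fun _ _ hs => riemannZeta_ne_zero_of_one_le_re hs⟩
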